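/- All functions are real-valued functions on $\mathbb R$. For $f\in L^2(\mathbb R)$ we write $f\in\dot H^{-1}$ if $f=u_x$ in the sense of distributions for some (necessarily unique) $u\in L^2(\mathbb R)$, and then $\partial_x^{-1}f:=u$; we write $f\in\dot H^{-2}$ if moreover $\partial_x^{-1}f\in\dot H^{-1}$, and then $\partial_x^{-2}f:=\partial_x^{-1}(\partial_x^{-1}f)$. For $p>1$ and $\lambda>0$ consider, over the set $\{u\in H^1(\mathbb R)\cap\dot H^{-1}(\mathbb R):\ \int_{\mathbb R}u^2\,dx=\lambda\}$, the minimization of $$\mathcal I[u]=\frac12\int_{\mathbb R}\big(|u'|^2+|\partial_x^{-1}u|^2\big)dx-\frac1{p+1}\int_{\mathbb R}|u|^pu\,dx,\qquad \mathcal J[u]=\frac12\int_{\mathbb R}\big(|u'|^2+|\partial_x^{-1}u|^2\big)dx-\frac1{p+1}\int_{\mathbb R}|u|^{p+1}dx .$$ (i) Let $1<p<3$, $\lambda>0$, and let $\phi_\lambda$ be a minimizer of $\mathcal I$ on this set. Put $$\omega=\omega(\lambda,\phi_\lambda)=\frac1\lambda\int_{\mathbb R}\big(|\phi_\lambda'|^2+|\partial_x^{-1}\phi_\lambda|^2-|\phi_\lambda|^p\phi_\lambda\big)dx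 .$$ Then $\phi_\lambda\in H^2\cap\dot H^{-2}$ and $$\partial_x^2\phi_\lambda+\partial_x^{-2}\phi_\lambda+\omega\phi_\lambda+|\phi_\lambda|^p=0$$ as an identity in $L^2(\mathbb R)$. Moreover, the linearized operator $$\mathcal L_+=-\partial_x^2-\partial_x^{-2}-\omega-p|\phi_\lambda|^{p-2}\phi_\lambda ,\qquad D(\mathcal L_+)=H^2\cap\dot H^{-2},$$ satisfies $\langle\mathcal L_+h,h\rangle\ge0$ for all $h\in D(\mathcal L_+)$ with $h\perp\phi_\lambda$ in $L^2(\mathbb R)$, and it has exactly one negative eigenvalue, counted with multiplicity. (ii) Let $1<p<5$, $\lambda>0$, and let $\phi_\lambda$ be a minimizer of $\mathcal J$ on this set. Put $$\omega=\omega(\lambda,\phi_\lambda)=\frac1\lambda\int_{\mathbb R}\big(|\phi_\lambda'|^2+|\partial_x^{-1}\phi_\lambda|^2-|\phi_\lambda|^{p+1}\big)dx .$$ Then $\phi_\lambda\in H^2\cap\dot H^{-2}$ and $$\partial_x^2\phi_\lambda+\partial_x^{-2}\phi_\lambda+\omega\phi_\lambda+|\phi_\lambda|^{p-1}\phi_\lambda=0$$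 as an identity in $L^2(\mathbb R)$. Moreover, the linearized operator $$\mathcal L_+=-\partial_x^2-\partial_x^{-2}-\omega-p|\phi_\lambda|^{p-1},\qquad D(\mathcal L_+)=H^2\cap\dot H^{-2},$$ satisfies $\langle\mathcal L_+h,h\rangle\ge0$ for all $h\in D(\mathcal L_+)$ with $h\perp\phi_\lambda$ in $L^2(\mathbb R)$, and it has exactly one negative eigenvalue, counted with multiplicity. -/

import Mathlib

open MeasureTheory
open scoped ContDiff

noncomputable section

namespace Ostrovsky

/-- The real Hilbert space `L²(ℝ)`. -/
abbrev L2 : Type := Lp ℝ 2 (volume : Measure ℝ)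

/-- `v = u_x` in the sense of distributions, for `u, v ∈ L²(ℝ)`. -/
def IsWeakDeriv (u v : L2) : Prop :=
  ∀ θ : ℝ → ℝ, ContDiff ℝ ∞ θ → HasCompactSupport θ →
    ∫ x, u x * deriv θ x = -∫ x, v x * θ x

/-- `u ∈ H¹(ℝ)`. -/
def MemH1 (u : L2) : Prop := ∃ v : L2, IsWeakDeriv u v

/-- `u ∈ L²(ℝ) ∩ Ḣ⁻¹(ℝ)`: the function `u` is the distributional derivative of an element
of `L²(ℝ)`. -/
def MemHm1 (u : L2) : Prop := ∃ v : L2, IsWeakDeriv v u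

open Classical in
/-- `∂ₓ u` for `u ∈ H¹(ℝ)` (and `0` for all other `u`). -/
def dx (u : L2) : L2 := if h : MemH1 u then h.choose else 0

open Classical in
/-- `∂ₓ⁻¹ u`, the element of `L²(ℝ)` with derivative `u`, for `u ∈ L²(ℝ) ∩ Ḣ⁻¹(ℝ)`
(and `0` for all other `u`). -/
def dxInv (u : L2) : L2 := if h : MemHm1 u then h.choose else 0

/-- `u ∈ H²(ℝ)`. -/
def MemH2 (u : L2) : Prop := MemH1 u ∧ MemH1 (dx u)

/-- `u ∈ L²(ℝ) ∩ Ḣ⁻²(ℝ)`. -/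
def MemHm2 (u : L2) : Prop := MemHm1 u ∧ MemHm1 (dxInv u)

theorem L2.locallyIntegrable (u : L2) : LocallyIntegrable u volume :=
  (Lp.memLp u).locallyIntegrable (by norm_num)

theorem L2.integrable_mul (u : L2) {θ : ℝ → ℝ} (hθ : Continuous θ) (hc : HasCompactSupport θ) :
    Integrable (fun x => u x * θ x) := by
  simpa [mul_comm] using
    (L2.locallyIntegrable u).integrable_smul_left_of_hasCompactSupport hθ hc

/-- The weak derivative is unique. -/
theorem IsWeakDeriv.unique {u v w : L2} (hv : IsWeakDeriv u v) (hw : IsWeakDeriv u w) :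
    v = w := by
  have h : ∀ᵐ x, v x - w x = 0 := by
    refine ae_eq_zero_of_integral_contDiff_smul_eq_zero
      ((L2.locallyIntegrable v).sub (L2.locallyIntegrable w)) fun θ hθ hc => ?_
    have h1 := hv θ hθ hc
    have h2 := hw θ hθ hc
    have h3 : (fun x => θ x • (v x - w x)) = fun x => v x * θ x - w x * θ x := by
      funext x; simp only [smul_eq_mul]; ring
    rw [h3, integral_sub (L2.integrable_mul v hθ.continuous hc)
      (L2.integrable_mul w hθ.continuous hc)]
    linarith
  exact Lp.ext (h.mono fun x hx => by linarith)

/-- A compactly supported smooth function of mean zero is the derivative of another compactly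
supported smooth function. -/
theorem exists_primitive {w : ℝ → ℝ} (hw : ContDiff ℝ ∞ w) (hc : HasCompactSupport w)
    (h0 : ∫ x, w x = 0) :
    ∃ θ : ℝ → ℝ, ContDiff ℝ ∞ θ ∧ HasCompactSupport θ ∧ deriv θ = w := by
  obtain ⟨R, hR⟩ := hc.isCompact.isBounded.subset_closedBall 0
  have hz : ∀ x, R < |x| → w x = 0 := fun x hx => by
    by_contra hne
    have := hR (subset_tsupport w hne)
    simp only [Metric.mem_closedBall, dist_zero_right, Real.norm_eq_abs] at this
    linarith
  have hint : Integrable w := hw.continuous.integrable_of_hasCompactSupport hc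
  have hd : ∀ x, HasDerivAt (fun y => ∫ t in (-R - 1)..y, w t) (w x) x := fun x =>
    intervalIntegral.integral_hasDerivAt_right (hint.intervalIntegrable)
      (hw.continuous.stronglyMeasurableAtFilter _ _) hw.continuous.continuousAt
  have hderiv : deriv (fun y => ∫ t in (-R - 1)..y, w t) = w := funext fun x => (hd x).deriv
  refine ⟨fun y => ∫ t in (-R - 1)..y, w t, ?_, ?_, hderiv⟩
  · rw [contDiff_infty_iff_deriv, hderiv]
    exact ⟨fun x => (hd x).differentiableAt, hw⟩
  · refine HasCompactSupport.of_support_subset_isCompact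
      (isCompact_Icc (a := -R - 1) (b := |R| + 1)) fun x hx => ?_
    by_contra hne
    refine hx ?_
    rw [Set.mem_Icc, not_and_or, not_le, not_le] at hne
    rcases hne with h | h
    · refine intervalIntegral.integral_zero_ae (Filter.Eventually.of_forall fun t ht => hz t ?_)
      rw [Set.uIoc_of_ge h.le] at ht
      have := neg_le_abs t
      linarith [ht.2]
    · change ∫ t in (-R - 1)..x, w t = 0
      have hx' : -R - 1 ≤ x := by linarith [neg_abs_le R]
      rw [intervalIntegral.integral_of_le hx', ← h0]
      refine setIntegral_eq_integral_of_forall_compl_eq_zero fun t ht => hz t ?_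
      rw [Set.mem_Ioc, not_and_or, not_lt, not_le] at ht
      rcases ht with ht | ht
      · have := neg_le_abs t
        linarith
      · have := le_abs_self t
        linarith [le_abs_self R]

/-- The antiderivative in `L²(ℝ)` is unique. -/
theorem IsWeakDeriv.unique_left {u v w : L2} (hv : IsWeakDeriv v u) (hw : IsWeakDeriv w u) :
    v = w := by
  obtain ⟨b, hb⟩ : ∃ b : ContDiffBump (0 : ℝ), b.rIn = 1 := ⟨⟨1, 2, one_pos, one_lt_two⟩, rfl⟩
  set η : ℝ → ℝ := b.normed volume
  have hη : ContDiff ℝ ∞ η := b.contDiff_normed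
  have hηc : HasCompactSupport η := b.hasCompactSupport_normed
  have hη1 : ∫ x, η x = 1 := b.integral_normed
  set f : L2 := v - w with hf
  have hfx : ∀ θ : ℝ → ℝ, ContDiff ℝ ∞ θ → HasCompactSupport θ →
      ∫ x, f x * deriv θ x = 0 := fun θ hθ hc => by
    have hcd : Continuous (deriv θ) := hθ.continuous_deriv (by simp)
    have h1 : ∫ x, f x * deriv θ x = ∫ x, (v x * deriv θ x - w x * deriv θ x) := by
      refine integral_congr_ae ((Lp.coeFn_sub v w).mono fun x hx => ?_)
      simp only [hf, hx, Pi.sub_apply]; ring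
    rw [h1, integral_sub (L2.integrable_mul v hcd hc.deriv) (L2.integrable_mul w hcd hc.deriv),
      hv θ hθ hc, hw θ hθ hc, sub_self]
  set c : ℝ := ∫ x, f x * η x with hc
  have key : ∀ᵐ x, f x - c = 0 := by
    refine ae_eq_zero_of_integral_contDiff_smul_eq_zero
      ((L2.locallyIntegrable f).sub (locallyIntegrable_const c)) fun ψ hψ hψc => ?_
    have hψi : Integrable ψ := hψ.continuous.integrable_of_hasCompactSupport hψc
    have hηi : Integrable η := hη.continuous.integrable_of_hasCompactSupport hηc
    set m : ℝ := ∫ x, ψ x with hm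
    have hs : HasCompactSupport fun x => ψ x - m * η x := hψc.sub hηc.mul_left
    obtain ⟨θ, h1, h2, h3⟩ := exists_primitive (w := fun x => ψ x - m * η x)
      (hψ.sub (contDiff_const.mul hη)) hs (by
        rw [integral_sub hψi (hηi.const_mul m), integral_const_mul, hη1, ← hm]; ring)
    have h4 := hfx θ h1 h2
    rw [h3] at h4
    have h5 : (fun x => f x * (ψ x - m * η x)) = fun x => f x * ψ x - m * (f x * η x) := by
      funext x; ring
    rw [h5, integral_sub (L2.integrable_mul f hψ.continuous hψc)
      ((L2.integrable_mul f hη.continuous hηc).const_mul m), integral_const_mul, ← hc] at h4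
    have h6 : ∫ x, ψ x • (f x - c) = ∫ x, (f x * ψ x - c * ψ x) := by
      refine integral_congr_ae (Filter.Eventually.of_forall fun x => ?_)
      simp only [smul_eq_mul]; ring
    rw [h6, integral_sub (L2.integrable_mul f hψ.continuous hψc) (hψi.const_mul c),
      integral_const_mul, ← hm]
    linarith
  have hc0 : c = 0 := by
    have h1 : MemLp (fun _ : ℝ => c) 2 (volume : Measure ℝ) :=
      (memLp_congr_ae (key.mono fun x hx => by linarith)).1 (Lp.memLp f)
    simpa [memLp_const_iff (show (2 : ENNReal) ≠ 0 by norm_num) (by norm_num)] using h1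
  have hf0 : f = 0 := by
    refine Lp.ext ?_
    filter_upwards [key, Lp.coeFn_zero ℝ 2 (volume : Measure ℝ)] with x hx h0
    rw [h0, Pi.zero_apply]; linarith
  exact sub_eq_zero.1 hf0

theorem IsWeakDeriv.dx_eq {u v : L2} (h : IsWeakDeriv u v) : dx u = v := by
  have hu : MemH1 u := ⟨v, h⟩
  rw [dx, dif_pos hu]
  exact hu.choose_spec.unique h

theorem IsWeakDeriv.dxInv_eq {u v : L2} (h : IsWeakDeriv v u) : dxInv u = v := by
  have hu : MemHm1 u := ⟨v, h⟩
  rw [dxInv, dif_pos hu]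
  exact hu.choose_spec.unique_left h

/-- The energy `½ ∫ |u'|² + |∂ₓ⁻¹u|² dx - 1/(p+1) ∫ |u|^p u dx`. -/
def energyI (p : ℝ) (u : L2) : ℝ :=
  1 / 2 * (∫ x, (|dx u x| ^ 2 + |dxInv u x| ^ 2)) - 1 / (p + 1) * ∫ x, |u x| ^ p * u x

/-- The energy `½ ∫ |v'|² + |∂ₓ⁻¹v|² dx - 1/(p+1) ∫ |v|^(p+1) dx`. -/
def energyJ (p : ℝ) (v : L2) : ℝ :=
  1 / 2 * (∫ x, (|dx v x| ^ 2 + |dxInv v x| ^ 2)) - 1 / (p + 1) * ∫ x, |v x| ^ (p + 1)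

/-- The admissible set `{u ∈ H¹ ∩ Ḣ⁻¹ : ∫ u² dx = lam}`. -/
def admissible (lam : ℝ) : Set L2 := {u | MemH1 u ∧ MemHm1 u ∧ ∫ x, |u x| ^ 2 = lam}

/-- `φ` minimizes `E` over the admissible set. -/
def IsMinimizer (E : L2 → ℝ) (lam : ℝ) (φ : L2) : Prop :=
  φ ∈ admissible lam ∧ ∀ u ∈ admissible lam, E φ ≤ E u

/-- The Lagrange multiplier for `energyI`. -/
def omegaI (p lam : ℝ) (φ : L2) : ℝ :=
  1 / lam * ∫ x, (|dx φ x| ^ 2 + |dxInv φ x| ^ 2 - |φ x| ^ p * φ x)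

/-- The Lagrange multiplier for `energyJ`. -/
def omegaJ (p lam : ℝ) (φ : L2) : ℝ :=
  1 / lam * ∫ x, (|dx φ x| ^ 2 + |dxInv φ x| ^ 2 - |φ x| ^ (p + 1))

/-- `φ ∈ H² ∩ Ḣ⁻²` and `∂ₓ²φ + ∂ₓ⁻²φ + om φ + N(φ) = 0` as an identity in `L²(ℝ)`. -/
def SolvesProfile (om : ℝ) (N : ℝ → ℝ) (φ : L2) : Prop :=
  MemH2 φ ∧ MemHm2 φ ∧
    ∀ᵐ x, dx (dx φ) x + dxInv (dxInv φ) x + om * φ x + N (φ x) = 0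

/-- The domain `H² ∩ Ḣ⁻²` of the linearized operator. -/
def linDomain : Set L2 := {h | MemH2 h ∧ MemHm2 h}

/-- The linearized operator `-∂ₓ² - ∂ₓ⁻² - om - V`, on `linDomain`. -/
def linOp (om : ℝ) (V : ℝ → ℝ) (h : L2) (x : ℝ) : ℝ :=
  -dx (dx h) x - dxInv (dxInv h) x - om * h x - V x * h x

/-- `⟨T h, h⟩ ≥ 0` for all `h` in the domain `H² ∩ Ḣ⁻²` with `h ⟂ φ`. -/
def NonnegOnPerp (T : L2 → ℝ → ℝ) (φ : L2) : Prop :=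
  ∀ h ∈ linDomain, ∫ x, h x * φ x = 0 → 0 ≤ ∫ x, T h x * h x

/-- `h` is an eigenfunction of `T` (with domain `H² ∩ Ḣ⁻²`) for the eigenvalue `μ`. -/
def IsEigenfunction (T : L2 → ℝ → ℝ) (μ : ℝ) (h : L2) : Prop :=
  h ∈ linDomain ∧ h ≠ 0 ∧ ∀ᵐ x, T h x = μ * h x

/-- `T` has exactly one negative eigenvalue, counted with multiplicity. -/
def HasExactlyOneNegativeEigenvalue (T : L2 → ℝ → ℝ) : Prop :=
  ∃ μ < 0, ∃ ψ : L2, IsEigenfunction T μ ψ ∧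
    ∀ ν < 0, ∀ h : L2, IsEigenfunction T ν h → ν = μ ∧ ∃ c : ℝ, h = c • ψ

end Ostrovsky

end

/-!
A minimizer `φ` is bounded, because `H¹(ℝ) ⊂ L^∞(ℝ)`, so the potential term of the energy is twice
differentiable along every great circle `cos t φ + sin t h` with `h ⟂ φ` and `‖h‖ = ‖φ‖`, which
stays in the constraint set. The first derivative at `t = 0` gives the Euler-Lagrange equation in
weak form, and the second derivative says that the quadratic form of `L₊` is nonnegative on `φ^⊥`
(`IsSphereMinimizer.euler_lagrange`). Both energies are treated at once, through a potential `F`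
with `F' = N` and continuous `N'`.

Weak solutions `u ∈ H¹ ∩ Ḣ⁻¹` of `-u'' - ∂ₓ⁻²u = f` with `f ∈ L²` are strong
(`exists_isWeakDeriv_of_weak_solution`). No Fourier transform is used: test functions are dense in
`H¹` (`h1Graph_le_closure_testGraph`), which gives integration by parts in `H¹`, and the resolvent
of `∂ₓ²`, obtained by an orthogonal projection, provides an explicit candidate in `H⁴` for
`-∂ₓ⁻²u`, up to a lower order error absorbed by positivity. Applied to the Euler-Lagrange equation
this gives the profile equation; applied to weak eigenfunctions it puts them in the domain of `L₊`.

Both nonlinearities satisfy `N'(z) z = p N(z)`, so that `⟨L₊ φ, φ⟩ = (1 - p) ∫ N(φ) φ`. This is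
negative: for `|φ|^(p - 1) φ` trivially, and for `|φ|^p` by comparison of `φ` with `-φ`
(`inner_pos_of_isMinimizer_energyI`). A form that is negative somewhere and nonnegative on a
hyperplane attains the infimum of its Rayleigh quotient, without any compactness
(`exists_negative_eigenvector`); hence a negative eigenvalue exists. Two independent eigenfunctions
with negative eigenvalues would span a vector of `φ^⊥` at which the form is negative
(`FormNonnegOnPerp.eigenfunction_unique`).
-/

noncomputable section

namespace Ostrovsky

open Filter Topology

/-! ### Weak derivatives on the line -/

theorem L2.inner_eq (u v : L2) : inner ℝ u v = ∫ x, u x * v x := by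
  rw [L2.inner_def]
  exact integral_congr_ae (Eventually.of_forall fun x => by simp [mul_comm])

theorem L2.integrable_mul_self (u v : L2) : Integrable (fun x => u x * v x) := by
  have := L2.integrable_inner (𝕜 := ℝ) u v
  simpa [mul_comm] using this

/-- The element of `L²(ℝ)` represented by a continuous compactly supported function. -/
def testL2 (θ : ℝ → ℝ) (hθ : Continuous θ) (hc : HasCompactSupport θ) : L2 :=
  (hθ.memLp_of_hasCompactSupport hc).toLp θ

theorem testL2_coe (θ : ℝ → ℝ) (hθ : Continuous θ) (hc : HasCompactSupport θ) :
    testL2 θ hθ hc =ᵐ[volume] θ :=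
  MemLp.coeFn_toLp _

theorem inner_testL2 (u : L2) (θ : ℝ → ℝ) (hθ : Continuous θ) (hc : HasCompactSupport θ) :
    inner ℝ u (testL2 θ hθ hc) = ∫ x, u x * θ x := by
  rw [L2.inner_eq]
  exact integral_congr_ae ((testL2_coe θ hθ hc).mono fun x hx => by simp only [hx])

theorem isWeakDeriv_iff_inner {u v : L2} :
    IsWeakDeriv u v ↔ ∀ (θ : ℝ → ℝ) (hθ : ContDiff ℝ ∞ θ) (hc : HasCompactSupport θ),
      inner ℝ u (testL2 (deriv θ) (hθ.continuous_deriv (by simp)) hc.deriv) =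
        -inner ℝ v (testL2 θ hθ.continuous hc) := by
  simp only [inner_testL2]
  rfl

theorem IsWeakDeriv.add {u v u' v' : L2} (h : IsWeakDeriv u v) (h' : IsWeakDeriv u' v') :
    IsWeakDeriv (u + u') (v + v') := by
  rw [isWeakDeriv_iff_inner] at *
  intro θ hθ hc
  rw [inner_add_left, inner_add_left, h θ hθ hc, h' θ hθ hc]
  ring

theorem IsWeakDeriv.smul {u v : L2} (c : ℝ) (h : IsWeakDeriv u v) :
    IsWeakDeriv (c • u) (c • v) := by
  rw [isWeakDeriv_iff_inner] at *
  intro θ hθ hc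
  rw [real_inner_smul_left, real_inner_smul_left, h θ hθ hc]
  ring

theorem IsWeakDeriv.neg {u v : L2} (h : IsWeakDeriv u v) : IsWeakDeriv (-u) (-v) := by
  simpa using h.smul (-1)

theorem IsWeakDeriv.sub {u v u' v' : L2} (h : IsWeakDeriv u v) (h' : IsWeakDeriv u' v') :
    IsWeakDeriv (u - u') (v - v') := by
  simpa [sub_eq_add_neg] using h.add h'.neg

theorem isWeakDeriv_zero : IsWeakDeriv 0 0 := by
  rw [isWeakDeriv_iff_inner]
  simp

theorem isClosed_isWeakDeriv {X : Type*} [TopologicalSpace X] {f g : X → L2}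
    (hf : Continuous f) (hg : Continuous g) : IsClosed {x | IsWeakDeriv (f x) (g x)} := by
  simp only [isWeakDeriv_iff_inner, Set.ofPred_forall]
  exact isClosed_iInter fun θ => isClosed_iInter fun hθ => isClosed_iInter fun hc =>
    isClosed_eq (by fun_prop) (by fun_prop)

/-- The lemma of du Bois-Reymond: a locally integrable function with vanishing distributional
derivative is constant. -/
theorem ae_eq_const_of_integral_mul_deriv_eq_zero {f : ℝ → ℝ} (hf : LocallyIntegrable f volume)
    (hfx : ∀ θ : ℝ → ℝ, ContDiff ℝ ∞ θ → HasCompactSupport θ → ∫ x, f x * deriv θ x = 0) :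
    ∃ c : ℝ, ∀ᵐ x, f x = c := by
  have hmul : ∀ {θ : ℝ → ℝ}, Continuous θ → HasCompactSupport θ →
      Integrable (fun x => f x * θ x) := fun hθ hc => by
    simpa [mul_comm] using hf.integrable_smul_left_of_hasCompactSupport hθ hc
  let b : ContDiffBump (0 : ℝ) := ⟨1, 2, one_pos, one_lt_two⟩
  set η : ℝ → ℝ := b.normed volume
  have hη : ContDiff ℝ ∞ η := b.contDiff_normed
  have hηc : HasCompactSupport η := b.hasCompactSupport_normed
  have hη1 : ∫ x, η x = 1 := b.integral_normed
  set c : ℝ := ∫ x, f x * η x with hc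
  have key : ∀ᵐ x, f x - c = 0 := by
    refine ae_eq_zero_of_integral_contDiff_smul_eq_zero
      (hf.sub (locallyIntegrable_const c)) fun ψ hψ hψc => ?_
    have hψi : Integrable ψ := hψ.continuous.integrable_of_hasCompactSupport hψc
    have hηi : Integrable η := hη.continuous.integrable_of_hasCompactSupport hηc
    set m : ℝ := ∫ x, ψ x with hm
    have hs : HasCompactSupport fun x => ψ x - m * η x := hψc.sub hηc.mul_left
    obtain ⟨θ, h1, h2, h3⟩ := exists_primitive (w := fun x => ψ x - m * η x)
      (hψ.sub (contDiff_const.mul hη)) hs (by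
        rw [integral_sub hψi (hηi.const_mul m), integral_const_mul, hη1, ← hm]; ring)
    have h4 := hfx θ h1 h2
    rw [h3] at h4
    have h5 : (fun x => f x * (ψ x - m * η x)) = fun x => f x * ψ x - m * (f x * η x) := by
      funext x; ring
    rw [h5, integral_sub (hmul hψ.continuous hψc)
      ((hmul hη.continuous hηc).const_mul m), integral_const_mul, ← hc] at h4
    have h6 : ∫ x, ψ x • (f x - c) = ∫ x, (f x * ψ x - c * ψ x) := by
      refine integral_congr_ae (Eventually.of_forall fun x => ?_)
      simp only [smul_eq_mul]; ring
    rw [h6, integral_sub (hmul hψ.continuous hψc) (hψi.const_mul c),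
      integral_const_mul, ← hm]
    linarith
  exact ⟨c, key.mono fun x hx => by linarith⟩

/-- The equation `s' = a s` with `a ≠ 0` has no nonzero solution in `L²(ℝ)`: the distributional
derivative of `exp (-a x) s` vanishes, so `s` is a multiple of `exp (a x)`. -/
theorem IsWeakDeriv.eq_zero_of_smul {s : L2} {a : ℝ} (ha : a ≠ 0) (h : IsWeakDeriv s (a • s)) :
    s = 0 := by
  have hE : ContDiff ℝ ∞ fun x : ℝ => Real.exp (-a * x) := by fun_prop
  have hloc : LocallyIntegrable (fun x => Real.exp (-a * x) * s x) volume := by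
    simpa [locallyIntegrableOn_univ] using
      (locallyIntegrableOn_univ.2 (L2.locallyIntegrable s)).continuousOn_mul
        hE.continuous.continuousOn isOpen_univ.isLocallyClosed
  obtain ⟨c, hc⟩ := ae_eq_const_of_integral_mul_deriv_eq_zero hloc fun θ hθ hθc => by
    have h1 := h (fun x => Real.exp (-a * x) * θ x) (hE.mul hθ) hθc.mul_left
    have hd : ∀ x, deriv (fun x => Real.exp (-a * x) * θ x) x =
        -a * (Real.exp (-a * x) * θ x) + Real.exp (-a * x) * deriv θ x := fun x => by
      have e1 : HasDerivAt (fun x : ℝ => Real.exp (-a * x)) (Real.exp (-a * x) * (-a)) x := by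
        simpa using ((hasDerivAt_id x).const_mul (-a)).exp
      have e2 : HasDerivAt θ (deriv θ x) x :=
        ((hθ.differentiable (by simp)) x).hasDerivAt
      refine Eq.trans (e1.mul e2).deriv ?_
      ring
    have hi1 : Integrable fun x => s x * (Real.exp (-a * x) * θ x) :=
      L2.integrable_mul s (hE.continuous.mul hθ.continuous) hθc.mul_left
    have hi2 : Integrable fun x => s x * (Real.exp (-a * x) * deriv θ x) :=
      L2.integrable_mul s (hE.continuous.mul (hθ.continuous_deriv (by simp))) hθc.deriv.mul_left
    have h2 : ∫ x, s x * deriv (fun x => Real.exp (-a * x) * θ x) x =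
        -a * (∫ x, s x * (Real.exp (-a * x) * θ x)) +
          ∫ x, s x * (Real.exp (-a * x) * deriv θ x) := by
      rw [← integral_const_mul, ← integral_add (hi1.const_mul _) hi2]
      refine integral_congr_ae (Eventually.of_forall fun x => ?_)
      simp only [hd]; ring
    have h3 : ∫ x, (a • s : L2) x * (Real.exp (-a * x) * θ x) =
        a * ∫ x, s x * (Real.exp (-a * x) * θ x) := by
      rw [← integral_const_mul]
      refine integral_congr_ae ((Lp.coeFn_smul a s).mono fun x hx => ?_)
      simp only [hx, Pi.smul_apply, smul_eq_mul]; ring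
    rw [h2, h3] at h1
    have h4 : ∫ x, Real.exp (-a * x) * s x * deriv θ x =
        ∫ x, s x * (Real.exp (-a * x) * deriv θ x) :=
      integral_congr_ae (Eventually.of_forall fun x => by ring)
    rw [h4]; linarith
  have hs : ∀ᵐ x, s x = c * Real.exp (a * x) := hc.mono fun x hx => by
    rw [← hx, mul_comm (Real.exp _), mul_assoc, ← Real.exp_add]
    simp
  have hc0 : c = 0 := by
    by_contra hne
    set S : Set ℝ := {x | 0 ≤ a * x} with hS
    have hSm : MeasurableSet S := measurableSet_le measurable_const (by fun_prop)
    have hSv : volume S = ⊤ := by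
      rcases lt_or_gt_of_ne ha with h0 | h0
      · have : S = Set.Iic 0 := by
          ext x; simp only [hS, Set.mem_ofPred_eq, Set.mem_Iic]
          exact ⟨fun hx => by by_contra! hx'; nlinarith, fun hx => by nlinarith⟩
        rw [this]; simp
      · have : S = Set.Ici 0 := by
          ext x; simp only [hS, Set.mem_ofPred_eq, Set.mem_Ici]
          exact ⟨fun hx => by by_contra! hx'; nlinarith, fun hx => by nlinarith⟩
        rw [this]; simp
    have hi : Integrable (fun x => s x * s x) := L2.integrable_mul_self s s
    have h1 : IntegrableOn (fun _ : ℝ => c ^ 2) S := by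
      refine Integrable.mono' hi.integrableOn (by fun_prop) ?_
      rw [ae_restrict_iff' hSm]
      filter_upwards [hs] with x hx hxS
      have h1 : 1 ≤ Real.exp (a * x) := Real.one_le_exp hxS
      rw [hx, Real.norm_eq_abs, abs_of_nonneg (sq_nonneg c)]
      nlinarith [mul_nonneg (sq_nonneg c) (by nlinarith : 0 ≤ Real.exp (a * x) ^ 2 - 1)]
    rw [integrableOn_const_iff] at h1
    simp [hSv, hne] at h1
  refine Lp.ext ?_
  filter_upwards [hs, Lp.coeFn_zero ℝ 2 (volume : Measure ℝ)] with x hx h0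
  rw [h0, hx, hc0]; simp

/-! ### Density of test functions, integration by parts, and boundedness -/

/-- The graph of `∂ₓ` on `H¹(ℝ)`, as a subspace of the Hilbert space `L² ⊕ L²`. -/
def h1Graph : Submodule ℝ (WithLp 2 (L2 × L2)) where
  carrier := {z | IsWeakDeriv z.fst z.snd}
  add_mem' h h' := IsWeakDeriv.add h h'
  zero_mem' := isWeakDeriv_zero
  smul_mem' c _ h := IsWeakDeriv.smul c h

theorem isClosed_h1Graph : IsClosed (h1Graph : Set (WithLp 2 (L2 × L2))) :=
  isClosed_isWeakDeriv (WithLp.continuous_fst _ _ _) (WithLp.continuous_snd _ _ _)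

/-- The part of the graph of `∂ₓ` lying over the test functions. -/
def testGraph : Submodule ℝ (WithLp 2 (L2 × L2)) where
  carrier := {z | ∃ θ : ℝ → ℝ, ContDiff ℝ ∞ θ ∧ HasCompactSupport θ ∧
    z.fst =ᵐ[volume] θ ∧ z.snd =ᵐ[volume] deriv θ}
  add_mem' := by
    rintro z w ⟨θ, h1, h2, h3, h4⟩ ⟨η, k1, k2, k3, k4⟩
    refine ⟨θ + η, h1.add k1, h2.add k2, ?_, ?_⟩
    · exact (Lp.coeFn_add z.fst w.fst).trans (h3.add k3)
    · refine (Lp.coeFn_add z.snd w.snd).trans ((h4.add k4).trans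
        (Eventually.of_forall fun x => ?_))
      rw [deriv_add ((h1.differentiable (by simp)) x) ((k1.differentiable (by simp)) x)]
      rfl
  zero_mem' := ⟨0, contDiff_const, HasCompactSupport.zero, Lp.coeFn_zero _ _ _, by
    refine (Lp.coeFn_zero ℝ 2 volume).trans (Eventually.of_forall fun x => ?_)
    simp⟩
  smul_mem' := by
    rintro c z ⟨θ, h1, h2, h3, h4⟩
    refine ⟨c • θ, contDiff_const.smul h1, h2.smul_left (f := fun _ => c), ?_, ?_⟩
    · exact (Lp.coeFn_smul c z.fst).trans (h3.const_smul c)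
    · refine (Lp.coeFn_smul c z.snd).trans ((h4.const_smul c).trans
        (Eventually.of_forall fun x => ?_))
      rw [deriv_const_smul _ ((h1.differentiable (by simp)) x)]
      rfl

theorem testL2_mem_testGraph (θ : ℝ → ℝ) (hθ : ContDiff ℝ ∞ θ) (hc : HasCompactSupport θ) :
    WithLp.toLp 2 (testL2 θ hθ.continuous hc,
      testL2 (deriv θ) (hθ.continuous_deriv (by simp)) hc.deriv) ∈ testGraph :=
  ⟨θ, hθ, hc, testL2_coe θ hθ.continuous hc,
    testL2_coe (deriv θ) (hθ.continuous_deriv (by simp)) hc.deriv⟩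

theorem isWeakDeriv_of_mem_testGraph {z : WithLp 2 (L2 × L2)} (hz : z ∈ testGraph) :
    IsWeakDeriv z.fst z.snd := by
  obtain ⟨θ, h1, h2, h3, h4⟩ := hz
  intro η hη hηc
  have hd : ∀ {g : ℝ → ℝ}, ContDiff ℝ ∞ g → ∀ x, HasDerivAt g (deriv g x) x := fun hg x =>
    ((hg.differentiable (by simp)) x).hasDerivAt
  have hθ' : Continuous (deriv θ) := h1.continuous_deriv (by simp)
  have hη' : Continuous (deriv η) := hη.continuous_deriv (by simp)
  have e1 : ∫ x, z.fst x * deriv η x = ∫ x, θ x * deriv η x :=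
    integral_congr_ae (h3.mono fun x hx => by simp only [hx])
  have e2 : ∫ x, z.snd x * η x = ∫ x, deriv θ x * η x :=
    integral_congr_ae (h4.mono fun x hx => by simp only [hx])
  rw [e1, e2]
  exact integral_mul_deriv_eq_deriv_mul_of_integrable (fun x _ => hd h1 x) (fun x _ => hd hη x)
    ((h1.continuous.mul hη').integrable_of_hasCompactSupport h2.mul_right)
    ((hθ'.mul hη.continuous).integrable_of_hasCompactSupport hηc.mul_left)
    ((h1.continuous.mul hη.continuous).integrable_of_hasCompactSupport h2.mul_right)

/-- Test functions are dense in `H¹(ℝ)`. An element `z` of `H¹` orthogonal to them satisfies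
`z'' = z`, so `z + z'` and `z - z'` solve first order equations without nonzero solutions in
`L²`. -/
theorem h1Graph_le_closure_testGraph : h1Graph ≤ testGraph.topologicalClosure := by
  have hcomp : CompleteSpace testGraph.topologicalClosure :=
    testGraph.isClosed_topologicalClosure.completeSpace_coe
  have hle : testGraph.topologicalClosure ≤ h1Graph :=
    Submodule.topologicalClosure_minimal _ (fun z hz => isWeakDeriv_of_mem_testGraph hz)
      isClosed_h1Graph
  have hsup := Submodule.sup_orthogonal_inf_of_hasOrthogonalProjection hle
  have hbot : testGraph.topologicalClosureᗮ ⊓ h1Graph = ⊥ := by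
    rw [eq_bot_iff]
    rintro z ⟨hz, hz1⟩
    replace hz1 : IsWeakDeriv z.fst z.snd := hz1
    have hz2 : IsWeakDeriv z.snd z.fst := by
      rw [isWeakDeriv_iff_inner]
      intro θ hθ hc
      have := (Submodule.mem_orthogonal' _ _).1 hz _
        (testGraph.le_topologicalClosure (testL2_mem_testGraph θ hθ hc))
      rw [WithLp.prod_inner_apply] at this
      change inner ℝ z.fst _ + inner ℝ z.snd _ = 0 at this
      exact (eq_neg_of_add_eq_zero_right this)
    have h1 : z.fst + z.snd = 0 := by
      refine IsWeakDeriv.eq_zero_of_smul one_ne_zero ?_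
      simpa [add_comm] using hz1.add hz2
    have h2 : z.fst - z.snd = 0 := by
      refine IsWeakDeriv.eq_zero_of_smul (a := -1) (by norm_num) ?_
      simpa using hz1.sub hz2
    have h3 : z.snd = z.fst := (sub_eq_zero.1 h2).symm
    have h4 : (2 : ℝ) • z.fst = 0 := by rw [two_smul]; rw [h3] at h1; exact h1
    have h5 : z.fst = 0 := by simpa using h4
    rw [Submodule.mem_bot, ← norm_eq_zero, ← sq_eq_zero_iff, WithLp.prod_norm_sq_eq_of_L2, h3, h5]
    simp
  rw [hbot, sup_bot_eq] at hsup
  exact hsup.ge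

/-- Integration by parts in `H¹(ℝ)`. -/
theorem IsWeakDeriv.inner_eq_neg {u v h k : L2} (huv : IsWeakDeriv u v) (hhk : IsWeakDeriv h k) :
    inner ℝ v h = -inner ℝ u k := by
  have hcl : IsClosed {z : WithLp 2 (L2 × L2) | inner ℝ v z.fst = -inner ℝ u z.snd} := by
    have := WithLp.continuous_fst 2 L2 L2
    have := WithLp.continuous_snd 2 L2 L2
    exact isClosed_eq (by fun_prop) (by fun_prop)
  have hsub : (testGraph : Set (WithLp 2 (L2 × L2))) ⊆
      {z : WithLp 2 (L2 × L2) | inner ℝ v z.fst = -inner ℝ u z.snd} := by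
    rintro z ⟨θ, h1, h2, h3, h4⟩
    have h5 := huv θ h1 h2
    rw [Set.mem_ofPred_eq, L2.inner_eq, L2.inner_eq,
      integral_congr_ae (h3.mono fun x hx => by simp only [hx] :
        (fun x => v x * z.fst x) =ᵐ[volume] fun x => v x * θ x),
      integral_congr_ae (h4.mono fun x hx => by simp only [hx] :
        (fun x => u x * z.snd x) =ᵐ[volume] fun x => u x * deriv θ x), h5, neg_neg]
  have := closure_minimal hsub hcl
    (h1Graph_le_closure_testGraph (show WithLp.toLp 2 (h, k) ∈ h1Graph from hhk))
  exact this

/-- Elements of `H¹(ℝ)` are bounded, by passing to the limit in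
`θ(x)² = ∫_{-∞}^x 2 θ θ' ≤ ‖θ‖² + ‖θ'‖²`. -/
theorem IsWeakDeriv.exists_ae_bound {u v : L2} (huv : IsWeakDeriv u v) :
    ∃ C : ℝ, 0 ≤ C ∧ ∀ᵐ x, |u x| ≤ C := by
  have htest : ∀ z ∈ testGraph, ∀ᵐ x, |z.fst x| ≤ ‖z‖ := by
    rintro z ⟨θ, h1, h2, h3, h4⟩
    filter_upwards [h3] with x hx
    rw [hx]
    refine abs_le_of_sq_le_sq ?_ (norm_nonneg z)
    have hθ' : Continuous (deriv θ) := h1.continuous_deriv (by simp)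
    have hd : ∀ x, deriv (fun y => θ y ^ 2) x = 2 * (θ x * deriv θ x) := fun x => by
      have := (((h1.differentiable (by simp)) x).hasDerivAt.pow 2).deriv
      simp only [Nat.cast_ofNat, Nat.add_one_sub_one, pow_one] at this
      rw [show (fun y => θ y ^ 2) = θ ^ 2 from rfl, this]; ring
    have hc2 : HasCompactSupport fun y => θ y ^ 2 := by
      simp only [pow_two]; exact h2.mul_right
    have e1 := HasCompactSupport.integral_Iic_deriv_eq ((h1.pow 2).of_le (by simp)) hc2 x
    rw [← e1]
    have hi1 : Integrable fun y => θ y * θ y :=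
      (h1.continuous.mul h1.continuous).integrable_of_hasCompactSupport h2.mul_right
    have hi2 : Integrable fun y => deriv θ y * deriv θ y :=
      (hθ'.mul hθ').integrable_of_hasCompactSupport h2.deriv.mul_right
    have hi3 : Integrable fun y => 2 * (θ y * deriv θ y) :=
      ((h1.continuous.mul hθ').integrable_of_hasCompactSupport h2.mul_right).const_mul 2
    calc ∫ y in Set.Iic x, deriv (fun y => θ y ^ 2) y
        ≤ ∫ y in Set.Iic x, (θ y * θ y + deriv θ y * deriv θ y) := by
          simp only [hd]
          exact integral_mono hi3.integrableOn (hi1.add hi2).integrableOn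
            fun y => by nlinarith [sq_nonneg (θ y - deriv θ y)]
      _ ≤ ∫ y, (θ y * θ y + deriv θ y * deriv θ y) :=
          setIntegral_le_integral (hi1.add hi2)
            (Eventually.of_forall fun y => add_nonneg (mul_self_nonneg _) (mul_self_nonneg _))
      _ = ‖z‖ ^ 2 := by
          rw [integral_add hi1 hi2, WithLp.prod_norm_sq_eq_of_L2, ← real_inner_self_eq_norm_sq,
            ← real_inner_self_eq_norm_sq, L2.inner_eq, L2.inner_eq]
          congr 1
          · exact integral_congr_ae (h3.mono fun x hx => by simp only [hx])
          · exact integral_congr_ae (h4.mono fun x hx => by simp only [hx])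
  obtain ⟨z, hz, hlim⟩ := mem_closure_iff_seq_limit.1
    (h1Graph_le_closure_testGraph (show WithLp.toLp 2 (u, v) ∈ h1Graph from huv))
  have hfst : Tendsto (fun n => (z n).fst) atTop (𝓝 u) :=
    ((WithLp.continuous_fst 2 L2 L2).tendsto _).comp hlim
  obtain ⟨ns, hns, hae⟩ := (tendstoInMeasure_of_tendsto_Lp hfst).exists_seq_tendsto_ae
  refine ⟨‖WithLp.toLp 2 (u, v)‖, norm_nonneg _, ?_⟩
  filter_upwards [hae, ae_all_iff.2 fun n => htest (z n) (hz n)] with x hx hb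
  exact le_of_tendsto_of_tendsto hx.abs (hlim.norm.comp hns.tendsto_atTop)
    (Eventually.of_forall fun n => hb (ns n))

/-! ### Regularity for `-∂ₓ² - ∂ₓ⁻²` -/

/-- Solvability of `q - q'' = F` in `L²(ℝ)`: project `(F, 0)` orthogonally onto the graph
of `∂ₓ`. -/
theorem exists_sub_deriv_deriv_eq (F : L2) :
    ∃ q r : L2, IsWeakDeriv q r ∧ IsWeakDeriv r (q - F) := by
  have hcomp : CompleteSpace h1Graph := isClosed_h1Graph.completeSpace_coe
  set P := h1Graph.starProjection (WithLp.toLp 2 (F, 0)) with hP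
  have hPm : P ∈ h1Graph := h1Graph.starProjection_apply_mem _
  refine ⟨P.fst, P.snd, hPm, ?_⟩
  rw [isWeakDeriv_iff_inner]
  intro θ hθ hc
  have h1 := h1Graph.starProjection_inner_eq_zero (WithLp.toLp 2 (F, 0)) _
    (isWeakDeriv_of_mem_testGraph (testL2_mem_testGraph θ hθ hc) :)
  rw [← hP, WithLp.prod_inner_apply] at h1
  change inner ℝ (F - P.fst) _ + inner ℝ (0 - P.snd) _ = 0 at h1
  rw [zero_sub, inner_neg_left] at h1
  rw [← inner_neg_left, neg_sub]
  exact (sub_eq_zero.1 (by rw [sub_eq_add_neg]; exact h1)).symm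

/-- Regularity: a weak solution `u ∈ H¹ ∩ Ḣ⁻¹` of `-u'' - ∂ₓ⁻² u = f` with `f ∈ L²` lies in
`H² ∩ Ḣ⁻²`. Writing `f = (1 - ∂ₓ²)² g - 2 u`, the identity
`(1 - ∂ₓ²)² = (1 + ∂ₓ⁴) - 2 ∂ₓ²` shows that `u + g''` solves the equation with right-hand side
`-2 (u + g'')`, so that it vanishes. -/
theorem exists_isWeakDeriv_of_weak_solution {u v w f : L2} (huv : IsWeakDeriv u v)
    (hwu : IsWeakDeriv w u)
    (hweak : ∀ h k g : L2, IsWeakDeriv h k → IsWeakDeriv g h →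
      inner ℝ v k + inner ℝ w g = inner ℝ f h) :
    ∃ v₂ w₂ : L2, IsWeakDeriv v v₂ ∧ IsWeakDeriv w₂ w ∧ -v₂ - w₂ = f := by
  obtain ⟨q, q₁, hq, hq₁⟩ := exists_sub_deriv_deriv_eq (f + (2 : ℝ) • u)
  obtain ⟨g, g₁, hg, hg₁⟩ := exists_sub_deriv_deriv_eq q
  have hg₂ : IsWeakDeriv (g - q) (g₁ - q₁) := hg.sub hq
  have hg₃ : IsWeakDeriv (g₁ - q₁) (g - q - (q - (f + (2 : ℝ) • u))) := hg₁.sub hq₁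
  set g₂ := g - q with hg₂_def
  set g₃ := g₁ - q₁
  set g₄ := g₂ - (q - (f + (2 : ℝ) • u)) with hg₄_def
  have hk : IsWeakDeriv (u + g₂) (v + g₃) := huv.add hg₂
  have hk' : IsWeakDeriv (w + g₁) (u + g₂) := hwu.add hg₁
  have hsum : g₄ + g = f + (2 : ℝ) • (u + g₂) := by
    rw [hg₄_def, hg₂_def]; module
  have h1 := hweak _ _ _ hk hk'
  have h2 : inner ℝ g₄ (u + g₂) = -inner ℝ g₃ (v + g₃) := hg₃.inner_eq_neg hk
  have h3 : inner ℝ g₁ (w + g₁) = -inner ℝ g (u + g₂) := hg.inner_eq_neg hk'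
  have h4 : inner ℝ (v + g₃) (v + g₃) + inner ℝ (w + g₁) (w + g₁) =
      -2 * inner ℝ (u + g₂) (u + g₂) := by
    have h5 : inner ℝ (g₄ + g) (u + g₂) =
        inner ℝ f (u + g₂) + 2 * inner ℝ (u + g₂) (u + g₂) := by
      rw [hsum, inner_add_left, real_inner_smul_left]
    rw [inner_add_left] at h5
    rw [inner_add_left v g₃, inner_add_left w g₁]
    linarith
  have h5 : u + g₂ = 0 := by
    rw [← inner_self_eq_zero (𝕜 := ℝ)]
    have a1 := real_inner_self_nonneg (x := v + g₃)
    have a2 := real_inner_self_nonneg (x := w + g₁)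
    have a3 := real_inner_self_nonneg (x := u + g₂)
    linarith
  have h6 : v + g₃ = 0 := by
    rw [h5] at hk; exact hk.unique isWeakDeriv_zero
  have h7 : w + g₁ = 0 := by
    rw [h5] at hk'; exact hk'.unique_left isWeakDeriv_zero
  refine ⟨-g₄, -g, ?_, ?_, ?_⟩
  · rw [eq_neg_of_add_eq_zero_left h6]; exact hg₃.neg
  · rw [eq_neg_of_add_eq_zero_left h7]; exact hg.neg
  · rw [neg_neg, sub_neg_eq_add, hsum, h5]; simp

/-! ### Nonlinearities and their superposition operators -/

/-- A `C²` potential `F` with first and second derivatives `N` and `N'`, vanishing to second order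
at `0`. -/
structure IsNonlinearity (F N N' : ℝ → ℝ) : Prop where
  hasDerivAt_potential : ∀ z, HasDerivAt F (N z) z
  hasDerivAt : ∀ z, HasDerivAt N (N' z) z
  continuous_deriv : Continuous N'
  potential_zero : F 0 = 0
  zero : N 0 = 0

namespace IsNonlinearity

variable {F N N' : ℝ → ℝ}

theorem continuous (hN : IsNonlinearity F N N') : Continuous N :=
  continuous_iff_continuousAt.2 fun z => (hN.hasDerivAt z).continuousAt

theorem continuous_potential (hN : IsNonlinearity F N N') : Continuous F :=
  continuous_iff_continuousAt.2 fun z => (hN.hasDerivAt_potential z).continuousAt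

theorem exists_bound (hN : IsNonlinearity F N N') (M : ℝ) :
    ∃ C : ℝ, 0 ≤ C ∧ ∀ z, |z| ≤ M → |N' z| ≤ C ∧ |N z| ≤ C * |z| ∧ |F z| ≤ C * z ^ 2 := by
  obtain ⟨C, hC⟩ := (isCompact_closedBall (0 : ℝ) M).exists_bound_of_continuousOn
    hN.continuous_deriv.continuousOn
  have hmem : ∀ {z r : ℝ}, |z| ≤ r ↔ z ∈ Metric.closedBall (0 : ℝ) r := by simp
  have h1 : ∀ z, |z| ≤ M → |N' z| ≤ max C 0 := fun z hz =>
    (hC z (hmem.1 hz)).trans (le_max_left _ _)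
  have h2 : ∀ z, |z| ≤ M → |N z| ≤ max C 0 * |z| := fun z hz => by
    have := (convex_closedBall (0 : ℝ) |z|).norm_image_sub_le_of_norm_hasDerivWithin_le
      (f := N) (f' := N') (C := max C 0) (fun y _ => (hN.hasDerivAt y).hasDerivWithinAt)
      (fun y hy => h1 y ((hmem.2 hy).trans hz)) (hmem.1 (by simp : |(0 : ℝ)| ≤ |z|))
      (hmem.1 le_rfl)
    simpa [hN.zero] using this
  refine ⟨max C 0, le_max_right _ _, fun z hz => ⟨h1 z hz, h2 z hz, ?_⟩⟩
  have := (convex_closedBall (0 : ℝ) |z|).norm_image_sub_le_of_norm_hasDerivWithin_le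
    (f := F) (f' := N) (C := max C 0 * |z|)
    (fun y _ => (hN.hasDerivAt_potential y).hasDerivWithinAt)
    (fun y hy => (h2 y ((hmem.2 hy).trans hz)).trans
      (mul_le_mul_of_nonneg_left (hmem.2 hy) (le_max_right _ _)))
    (hmem.1 (by simp : |(0 : ℝ)| ≤ |z|)) (hmem.1 le_rfl)
  simpa [hN.potential_zero, mul_assoc, ← pow_two] using this

theorem exists_comp (hN : IsNonlinearity F N N') {u : L2} {M : ℝ} (hu : ∀ᵐ x, |u x| ≤ M) :
    ∃ n : L2, n =ᵐ[volume] fun x => N (u x) := by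
  obtain ⟨C, -, hC⟩ := hN.exists_bound M
  have hmem : MemLp (fun x => N (u x)) 2 volume := by
    refine (Lp.memLp u).of_le_mul (c := C)
      (hN.continuous.comp_aestronglyMeasurable (Lp.aestronglyMeasurable u)) ?_
    filter_upwards [hu] with x hx
    exact (hC _ hx).2.1
  exact ⟨hmem.toLp _, hmem.coeFn_toLp⟩

end IsNonlinearity

/-- Multiplication by a bounded measurable function is a bounded operator on `L²(ℝ)`. -/
theorem exists_mul_operator {V : ℝ → ℝ} (hV : AEStronglyMeasurable V volume) {C : ℝ}
    (hC : ∀ᵐ x, |V x| ≤ C) :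
    ∃ T : L2 →L[ℝ] L2, ∀ u : L2, T u =ᵐ[volume] fun x => V x * u x := by
  have hmem : MemLp V ⊤ volume := memLp_top_of_bound hV C hC
  refine ⟨(ContinuousLinearMap.mul ℝ ℝ).holderL volume ⊤ 2 2 (hmem.toLp V), fun u => ?_⟩
  filter_upwards [(ContinuousLinearMap.mul ℝ ℝ).coeFn_holder (r := 2) (hmem.toLp V) u,
    hmem.coeFn_toLp] with x h1 h2
  rw [ContinuousLinearMap.holderL_apply_apply, h1, h2]
  rfl

/-- Multiplication by `N'(u)` for a bounded `u`. -/
theorem IsNonlinearity.exists_deriv_operator {F N N' : ℝ → ℝ} (hN : IsNonlinearity F N N')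
    {u v : L2} (hu : IsWeakDeriv u v) :
    ∃ T : L2 →L[ℝ] L2, ∀ h : L2, T h =ᵐ[volume] fun x => N' (u x) * h x := by
  obtain ⟨M, -, hM⟩ := hu.exists_ae_bound
  obtain ⟨C, -, hC⟩ := hN.exists_bound M
  exact exists_mul_operator
    (hN.continuous_deriv.comp_aestronglyMeasurable (Lp.aestronglyMeasurable u))
    (hM.mono fun x hx => (hC _ hx).1)

/-! ### Variation along great circles -/

theorem hasDerivAt_cos_sin (a b t : ℝ) :
    HasDerivAt (fun t => Real.cos t * a + Real.sin t * b)
      (Real.cos t * b - Real.sin t * a) t := by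
  exact (((Real.hasDerivAt_cos t).mul_const a).add
    ((Real.hasDerivAt_sin t).mul_const b)).congr_deriv (by ring)

theorem abs_cos_mul_add_sin_mul_le (a b t : ℝ) :
    |Real.cos t * a + Real.sin t * b| ≤ |a| + |b| := by
  refine (abs_add_le _ _).trans ?_
  rw [abs_mul, abs_mul]
  nlinarith [Real.abs_cos_le_one t, Real.abs_sin_le_one t, abs_nonneg a, abs_nonneg b]

theorem abs_cos_mul_sub_sin_mul_le (a b t : ℝ) :
    |Real.cos t * b - Real.sin t * a| ≤ |a| + |b| := by
  have := abs_cos_mul_add_sin_mul_le a b (t + Real.pi / 2)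
  rw [Real.cos_add_pi_div_two, Real.sin_add_pi_div_two] at this
  rwa [show Real.cos t * b - Real.sin t * a = -Real.sin t * a + Real.cos t * b by ring]

/-- A function with a minimum at `0` has vanishing first and nonnegative second derivative
there. -/
theorem deriv_eq_zero_and_second_deriv_nonneg {f f' : ℝ → ℝ} {c : ℝ}
    (hf : ∀ t, HasDerivAt f (f' t) t) (hf' : HasDerivAt f' c 0) (hmin : ∀ t, f 0 ≤ f t) :
    f' 0 = 0 ∧ 0 ≤ c := by
  have h0 : f' 0 = 0 :=
    IsLocalMin.hasDerivAt_eq_zero (Eventually.of_forall hmin) (hf 0)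
  refine ⟨h0, ?_⟩
  by_contra! hc
  have hd : deriv f = f' := funext fun t => (hf t).deriv
  have hmax : IsLocalMax f 0 := isLocalMax_of_deriv_deriv_neg (by rw [hd, hf'.deriv]; exact hc)
    (by rw [hd]; exact h0) (hf 0).continuousAt
  have hconst : f =ᶠ[𝓝 0] fun _ => f 0 := hmax.mono fun t ht => le_antisymm ht (hmin t)
  have hz : f' =ᶠ[𝓝 0] fun _ => 0 := by
    have := hconst.deriv
    rw [hd] at this
    simpa using this
  have := hf'.unique ((hasDerivAt_const (0 : ℝ) (0 : ℝ)).congr_of_eventuallyEq hz)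
  linarith

section Circle

variable {F N N' : ℝ → ℝ} {a b : L2} {M : ℝ}

theorem integrable_sq_abs_add_abs (a b : L2) :
    Integrable (fun x => (|a x| + |b x|) ^ 2) := by
  have h : MemLp (fun x => |a x| + |b x|) 2 volume := (Lp.memLp a).abs.add (Lp.memLp b).abs
  exact h.integrable_sq

theorem hasDerivAt_integral_potential (hN : IsNonlinearity F N N') (ha : ∀ᵐ x, |a x| ≤ M)
    (hb : ∀ᵐ x, |b x| ≤ M) (t : ℝ) :
    HasDerivAt (fun t => ∫ x, F (Real.cos t * a x + Real.sin t * b x))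
      (∫ x, N (Real.cos t * a x + Real.sin t * b x) *
        (Real.cos t * b x - Real.sin t * a x)) t := by
  obtain ⟨C, hC0, hC⟩ := hN.exists_bound (M + M)
  have hma := Lp.aestronglyMeasurable a
  have hmb := Lp.aestronglyMeasurable b
  have hG : ∀ s : ℝ, AEStronglyMeasurable
      (fun x => Real.cos s * a x + Real.sin s * b x) volume := fun s =>
    (hma.const_mul _).add (hmb.const_mul _)
  refine (hasDerivAt_integral_of_dominated_loc_of_deriv_le (s := Set.univ)
    (F' := fun t x => N (Real.cos t * a x + Real.sin t * b x) *
      (Real.cos t * b x - Real.sin t * a x))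
    (bound := fun x => C * (|a x| + |b x|) ^ 2) univ_mem
    (Eventually.of_forall fun s => hN.continuous_potential.comp_aestronglyMeasurable (hG s))
    ?_ ((hN.continuous.comp_aestronglyMeasurable (hG t)).mul
      ((hmb.const_mul _).sub (hma.const_mul _)))
    ?_ ((integrable_sq_abs_add_abs a b).const_mul C) ?_).2
  · refine ((integrable_sq_abs_add_abs a b).const_mul C).mono'
      (hN.continuous_potential.comp_aestronglyMeasurable (hG t)) ?_
    filter_upwards [ha, hb] with x hax hbx
    have h1 := abs_cos_mul_add_sin_mul_le (a x) (b x) t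
    refine (hC _ (h1.trans (add_le_add hax hbx))).2.2.trans ?_
    refine mul_le_mul_of_nonneg_left ?_ hC0
    rw [← sq_abs]
    gcongr
  · filter_upwards [ha, hb] with x hax hbx s _
    have h1 := abs_cos_mul_add_sin_mul_le (a x) (b x) s
    have h2 := abs_cos_mul_sub_sin_mul_le (a x) (b x) s
    have h3 := (hC _ (h1.trans (add_le_add hax hbx))).2.1
    rw [norm_mul, Real.norm_eq_abs, Real.norm_eq_abs, pow_two, ← mul_assoc]
    gcongr
    exact h3.trans (by gcongr)
  · exact Eventually.of_forall fun x s _ =>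
      (hN.hasDerivAt_potential _).comp s (hasDerivAt_cos_sin (a x) (b x) s)

theorem hasDerivAt_integral_nonlinearity (hN : IsNonlinearity F N N') (ha : ∀ᵐ x, |a x| ≤ M)
    (hb : ∀ᵐ x, |b x| ≤ M) :
    HasDerivAt (fun t => ∫ x, N (Real.cos t * a x + Real.sin t * b x) *
        (Real.cos t * b x - Real.sin t * a x))
      (∫ x, (N' (a x) * b x * b x - N (a x) * a x)) 0 := by
  obtain ⟨C, hC0, hC⟩ := hN.exists_bound (M + M)
  have hma := Lp.aestronglyMeasurable a
  have hmb := Lp.aestronglyMeasurable b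
  have hG : ∀ s : ℝ, AEStronglyMeasurable
      (fun x => Real.cos s * a x + Real.sin s * b x) volume := fun s =>
    (hma.const_mul _).add (hmb.const_mul _)
  have hG' : ∀ s : ℝ, AEStronglyMeasurable
      (fun x => Real.cos s * b x - Real.sin s * a x) volume := fun s =>
    (hmb.const_mul _).sub (hma.const_mul _)
  have hmeas : ∀ s : ℝ, AEStronglyMeasurable
      (fun x => N (Real.cos s * a x + Real.sin s * b x) *
        (Real.cos s * b x - Real.sin s * a x)) volume := fun s =>
    (hN.continuous.comp_aestronglyMeasurable (hG s)).mul (hG' s)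
  have key := (hasDerivAt_integral_of_dominated_loc_of_deriv_le (s := Set.univ) (x₀ := (0 : ℝ))
    (F := fun t x => N (Real.cos t * a x + Real.sin t * b x) *
        (Real.cos t * b x - Real.sin t * a x))
    (F' := fun t x => N' (Real.cos t * a x + Real.sin t * b x) *
        (Real.cos t * b x - Real.sin t * a x) * (Real.cos t * b x - Real.sin t * a x) -
        N (Real.cos t * a x + Real.sin t * b x) * (Real.cos t * a x + Real.sin t * b x))
    (bound := fun x => 2 * C * (|a x| + |b x|) ^ 2) univ_mem
    (Eventually.of_forall hmeas) ?_ ?_ ?_ ((integrable_sq_abs_add_abs a b).const_mul _) ?_).2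
  · simpa using key
  · refine ((integrable_sq_abs_add_abs a b).const_mul C).mono' (hmeas 0) ?_
    filter_upwards [ha, hb] with x hax hbx
    have h1 := abs_cos_mul_add_sin_mul_le (a x) (b x) 0
    have h2 := abs_cos_mul_sub_sin_mul_le (a x) (b x) 0
    have h3 := (hC _ (h1.trans (add_le_add hax hbx))).2.1
    rw [norm_mul, Real.norm_eq_abs, Real.norm_eq_abs, pow_two, ← mul_assoc]
    gcongr
    exact h3.trans (by gcongr)
  · exact (((hN.continuous_deriv.comp_aestronglyMeasurable (hG 0)).mul (hG' 0)).mul (hG' 0)).sub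
      ((hN.continuous.comp_aestronglyMeasurable (hG 0)).mul (hG 0))
  · filter_upwards [ha, hb] with x hax hbx s _
    have h1 := abs_cos_mul_add_sin_mul_le (a x) (b x) s
    have h2 := abs_cos_mul_sub_sin_mul_le (a x) (b x) s
    obtain ⟨h3, h4, -⟩ := hC _ (h1.trans (add_le_add hax hbx))
    set g := Real.cos s * a x + Real.sin s * b x
    set g' := Real.cos s * b x - Real.sin s * a x
    set m := |a x| + |b x|
    have h5 : |N' g * g' * g'| ≤ C * m ^ 2 := by
      rw [abs_mul, abs_mul, pow_two, ← mul_assoc]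
      gcongr
    have h6 : |N g * g| ≤ C * m ^ 2 := by
      rw [abs_mul, pow_two, ← mul_assoc]
      gcongr
      exact h4.trans (by gcongr)
    calc ‖N' g * g' * g' - N g * g‖ ≤ |N' g * g' * g'| + |N g * g| := abs_sub _ _
      _ ≤ 2 * C * m ^ 2 := by linarith
  · refine Eventually.of_forall fun x s _ => ?_
    have e1 := (hN.hasDerivAt _).comp s (hasDerivAt_cos_sin (a x) (b x) s)
    have e2 := hasDerivAt_cos_sin (b x) (-a x) s
    have e3 : HasDerivAt (fun t => Real.cos t * b x - Real.sin t * a x)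
        (-(Real.cos s * a x + Real.sin s * b x)) s := by
      convert e2 using 1
      · funext t; ring
      · ring
    refine (e1.mul e3).congr_deriv ?_
    simp only [Function.comp_apply]; ring

end Circle

/-- `φ`, with derivative `φ₁` and antiderivative `φm`, minimizes
`½ (‖u'‖² + ‖∂ₓ⁻¹u‖²) - ∫ F(u)` over the `u ∈ H¹ ∩ Ḣ⁻¹` with `‖u‖ = ‖φ‖`. -/
structure IsSphereMinimizer (F : ℝ → ℝ) (φ φ₁ φm : L2) : Prop where
  deriv : IsWeakDeriv φ φ₁
  antideriv : IsWeakDeriv φm φ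
  le : ∀ u v w : L2, IsWeakDeriv u v → IsWeakDeriv w u → ‖u‖ = ‖φ‖ →
    1 / 2 * (‖φ₁‖ ^ 2 + ‖φm‖ ^ 2) - ∫ x, F (φ x) ≤ 1 / 2 * (‖v‖ ^ 2 + ‖w‖ ^ 2) - ∫ x, F (u x)

/-- First and second variation along the great circle `cos t φ + sin t h`. -/
theorem IsSphereMinimizer.variation_of_norm_eq {F N N' : ℝ → ℝ} {φ φ₁ φm n : L2} {T : L2 →L[ℝ] L2}
    (hN : IsNonlinearity F N N') (hφ : IsSphereMinimizer F φ φ₁ φm)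
    (hn : n =ᵐ[volume] fun x => N (φ x)) (hT : ∀ u : L2, T u =ᵐ[volume] fun x => N' (φ x) * u x)
    {h k g : L2} (hk : IsWeakDeriv h k) (hg : IsWeakDeriv g h) (horth : inner ℝ φ h = 0)
    (hnorm : ‖h‖ = ‖φ‖) :
    inner ℝ φ₁ k + inner ℝ φm g = inner ℝ n h ∧
      0 ≤ ‖k‖ ^ 2 + ‖g‖ ^ 2 - inner ℝ (T h) h - (‖φ₁‖ ^ 2 + ‖φm‖ ^ 2 - inner ℝ n φ) := by
  obtain ⟨C₁, -, hC₁⟩ := hφ.deriv.exists_ae_bound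
  obtain ⟨C₂, -, hC₂⟩ := hk.exists_ae_bound
  have ha : ∀ᵐ x, |φ x| ≤ max C₁ C₂ := hC₁.mono fun x hx => hx.trans (le_max_left _ _)
  have hb : ∀ᵐ x, |h x| ≤ max C₁ C₂ := hC₂.mono fun x hx => hx.trans (le_max_right _ _)
  have hsq : ∀ (u v : L2) (t : ℝ), ‖Real.cos t • u + Real.sin t • v‖ ^ 2 =
      Real.cos t ^ 2 * ‖u‖ ^ 2 + 2 * (Real.cos t * Real.sin t) * inner ℝ u v +
        Real.sin t ^ 2 * ‖v‖ ^ 2 := fun u v t => by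
    rw [norm_add_sq_real, norm_smul, norm_smul, real_inner_smul_left, real_inner_smul_right,
      mul_pow, mul_pow, Real.norm_eq_abs, Real.norm_eq_abs, sq_abs, sq_abs]
    ring
  set A := ‖φ₁‖ ^ 2 + ‖φm‖ ^ 2 with hA
  set D := inner ℝ φ₁ k + inner ℝ φm g with hD
  set E := ‖k‖ ^ 2 + ‖g‖ ^ 2 with hE
  set P : ℝ → ℝ := fun t => ∫ x, F (Real.cos t * φ x + Real.sin t * h x)
  have hmin : ∀ t, 1 / 2 * (Real.cos 0 ^ 2 * A + 2 * (Real.cos 0 * Real.sin 0) * D +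
      Real.sin 0 ^ 2 * E) - P 0 ≤ 1 / 2 * (Real.cos t ^ 2 * A +
      2 * (Real.cos t * Real.sin t) * D + Real.sin t ^ 2 * E) - P t := fun t => by
    have h1 := hφ.le _ _ _ ((hφ.deriv.smul (Real.cos t)).add (hk.smul (Real.sin t)))
      ((hφ.antideriv.smul (Real.cos t)).add (hg.smul (Real.sin t))) (by
        rw [← sq_eq_sq₀ (norm_nonneg _) (norm_nonneg _), hsq, horth, hnorm]
        linear_combination ‖φ‖ ^ 2 * Real.cos_sq_add_sin_sq t)
    have h2 : ∫ x, F ((Real.cos t • φ + Real.sin t • h : L2) x) = P t := by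
      refine integral_congr_ae ?_
      filter_upwards [Lp.coeFn_add (Real.cos t • φ) (Real.sin t • h),
        Lp.coeFn_smul (Real.cos t) φ, Lp.coeFn_smul (Real.sin t) h] with x h1 h2 h3
      simp only [h1, h2, h3, Pi.add_apply, Pi.smul_apply, smul_eq_mul]
    have h3 : P 0 = ∫ x, F (φ x) := by simp [P]
    rw [h2, hsq, hsq] at h1
    rw [h3, Real.cos_zero, Real.sin_zero]
    linarith
  have hd : ∀ t, HasDerivAt (fun t => 1 / 2 * (Real.cos t ^ 2 * A +
      2 * (Real.cos t * Real.sin t) * D + Real.sin t ^ 2 * E) - P t)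
      (Real.cos t * Real.sin t * (E - A) + (Real.cos t ^ 2 - Real.sin t ^ 2) * D -
        ∫ x, N (Real.cos t * φ x + Real.sin t * h x) *
          (Real.cos t * h x - Real.sin t * φ x)) t := fun t => by
    have c := Real.hasDerivAt_cos t
    have s := Real.hasDerivAt_sin t
    have e := (((((c.pow 2).mul_const A).add (((c.mul s).const_mul 2).mul_const D)).add
      ((s.pow 2).mul_const E)).const_mul (1 / 2)).sub (hasDerivAt_integral_potential hN ha hb t)
    refine e.congr_deriv ?_
    simp only [Nat.cast_ofNat, Nat.add_one_sub_one, pow_one]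
    ring
  have hd' : HasDerivAt (fun t => Real.cos t * Real.sin t * (E - A) +
      (Real.cos t ^ 2 - Real.sin t ^ 2) * D - ∫ x, N (Real.cos t * φ x + Real.sin t * h x) *
          (Real.cos t * h x - Real.sin t * φ x))
      (E - A - ∫ x, (N' (φ x) * h x * h x - N (φ x) * φ x)) 0 := by
    have c := Real.hasDerivAt_cos 0
    have s := Real.hasDerivAt_sin 0
    have e := (((c.mul s).mul_const (E - A)).add (((c.pow 2).sub (s.pow 2)).mul_const D)).sub
      (hasDerivAt_integral_nonlinearity hN ha hb)
    refine e.congr_deriv ?_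
    simp
  obtain ⟨h1, h2⟩ := deriv_eq_zero_and_second_deriv_nonneg hd hd' hmin
  have en : ∀ u : L2, ∫ x, N (φ x) * u x = inner ℝ n u := fun u => by
    rw [L2.inner_eq]
    exact integral_congr_ae (hn.mono fun x hx => by simp only [hx])
  have eT : ∫ x, N' (φ x) * h x * h x = inner ℝ (T h) h := by
    rw [L2.inner_eq]
    exact integral_congr_ae ((hT h).mono fun x hx => by simp only [hx])
  have i1 : Integrable fun x => N' (φ x) * h x * h x :=
    (L2.integrable_mul_self (T h) h).congr ((hT h).mono fun x hx => by simp only [hx])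
  have i2 : Integrable fun x => N (φ x) * φ x :=
    (L2.integrable_mul_self n φ).congr (hn.mono fun x hx => by simp only [hx])
  rw [integral_sub i1 i2, eT, en] at h2
  simp only [Real.cos_zero, Real.sin_zero, one_mul, zero_mul, mul_zero, add_zero, sub_zero, en,
    one_pow, ne_eq, OfNat.ofNat_ne_zero, not_false_eq_true, zero_pow, zero_add] at h1
  exact ⟨by linarith, by linarith⟩

/-- The Euler-Lagrange equation, in weak form, and the second order condition on `φ^⊥`. -/
theorem IsSphereMinimizer.euler_lagrange {F N N' : ℝ → ℝ} {φ φ₁ φm n : L2} {T : L2 →L[ℝ] L2}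
    {om : ℝ} (hN : IsNonlinearity F N N') (hφ : IsSphereMinimizer F φ φ₁ φm) (hφ0 : φ ≠ 0)
    (hn : n =ᵐ[volume] fun x => N (φ x)) (hT : ∀ u : L2, T u =ᵐ[volume] fun x => N' (φ x) * u x)
    (hom : om * ‖φ‖ ^ 2 = ‖φ₁‖ ^ 2 + ‖φm‖ ^ 2 - inner ℝ n φ)
    {h k g : L2} (hk : IsWeakDeriv h k) (hg : IsWeakDeriv g h) :
    inner ℝ φ₁ k + inner ℝ φm g = inner ℝ (om • φ + n) h ∧
      (inner ℝ φ h = 0 →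
        0 ≤ ‖k‖ ^ 2 + ‖g‖ ^ 2 - om * ‖h‖ ^ 2 - inner ℝ (T h) h) := by
  have hφn : 0 < ‖φ‖ := norm_pos_iff.2 hφ0
  -- rescaling to the sphere of radius `‖φ‖`
  have key : ∀ {h k g : L2}, IsWeakDeriv h k → IsWeakDeriv g h → inner ℝ φ h = 0 →
      inner ℝ φ₁ k + inner ℝ φm g = inner ℝ n h ∧
        0 ≤ ‖k‖ ^ 2 + ‖g‖ ^ 2 - om * ‖h‖ ^ 2 - inner ℝ (T h) h := fun {h k g} hk hg horth => by
    rcases eq_or_ne h 0 with rfl | hne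
    · have h1 := hk.unique isWeakDeriv_zero
      have h2 := hg.unique_left isWeakDeriv_zero
      simp [h1, h2]
    set c := ‖φ‖ / ‖h‖ with hc
    have hhn : 0 < ‖h‖ := norm_pos_iff.2 hne
    have hc0 : 0 < c := div_pos hφn hhn
    have hch : c * ‖h‖ = ‖φ‖ := div_mul_cancel₀ _ hhn.ne'
    obtain ⟨h1, h2⟩ := hφ.variation_of_norm_eq hN hn hT (hk.smul c) (hg.smul c)
      (by rw [real_inner_smul_right, horth, mul_zero])
      (by rw [norm_smul, Real.norm_eq_abs, abs_of_pos hc0, hch])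
    rw [← hom, ← hch] at h2
    simp only [real_inner_smul_right, real_inner_smul_left, map_smul, norm_smul, Real.norm_eq_abs,
      abs_of_pos hc0] at h1 h2
    refine ⟨mul_left_cancel₀ hc0.ne' (by linarith), ?_⟩
    refine le_of_mul_le_mul_left ?_ (pow_pos hc0 2)
    rw [mul_zero]
    linarith
  refine ⟨?_, fun h0 => (key hk hg h0).2⟩
  set c := inner ℝ φ h / ‖φ‖ ^ 2 with hc
  have hcφ : c * ‖φ‖ ^ 2 = inner ℝ φ h := div_mul_cancel₀ _ (pow_pos hφn 2).ne'
  have h1 := (key (hk.sub (hφ.deriv.smul c)) (hg.sub (hφ.antideriv.smul c)) (by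
    rw [inner_sub_right, real_inner_smul_right, real_inner_self_eq_norm_sq, hcφ, sub_self])).1
  simp only [inner_sub_right, real_inner_smul_right, real_inner_self_eq_norm_sq] at h1
  rw [inner_add_left, real_inner_smul_left, ← hcφ]
  linear_combination h1 - c * hom

/-! ### Negative eigenvalues of forms that are nonnegative on a hyperplane -/

/-- The bounded bilinear form `(x, y) ↦ ⟪S x, T y⟫`. -/
def innerForm {E L : Type*} [NormedAddCommGroup E] [NormedSpace ℝ E] [NormedAddCommGroup L]
    [InnerProductSpace ℝ L] (S T : E →L[ℝ] L) : E →L[ℝ] E →L[ℝ] ℝ :=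
  (innerSL ℝ : L →L[ℝ] L →L[ℝ] ℝ).bilinearComp S T

/-- A symmetric form `B`, coercive up to a multiple of `‖ι x‖²`, negative at `φ` and nonnegative on
the `ι`-orthogonal complement of `φ`, has a negative eigenvalue relative to `‖ι x‖²`, namely the
infimum `m` of its Rayleigh quotient. The form `B - m ‖ι ·‖²` is coercive on that complement, so by
the Lax-Milgram theorem some `y = φ + w` with `w` in the complement is orthogonal to the complement
for it. If the form were positive at `y`, it would dominate a positive multiple of `‖ι ·‖²`, against
the choice of `m`. -/
theorem exists_negative_eigenvector {E L : Type*} [NormedAddCommGroup E] [InnerProductSpace ℝ E]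
    [CompleteSpace E] [NormedAddCommGroup L] [InnerProductSpace ℝ L] (ι : E →L[ℝ] L)
    (B : E →L[ℝ] E →L[ℝ] ℝ) (hsymm : ∀ x y, B x y = B y x) {c C : ℝ} (hc : 0 < c)
    (hcoer : ∀ x, c * ‖x‖ ^ 2 ≤ B x x + C * ‖ι x‖ ^ 2) {φ : E} (hneg : B φ φ < 0)
    (hperp : ∀ k, inner ℝ (ι φ) (ι k) = 0 → 0 ≤ B k k) :
    ∃ μ < 0, ∃ y : E, ι y ≠ 0 ∧ ∀ k, B y k = μ * inner ℝ (ι y) (ι k) := by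
  have hφ : 0 < ‖ι φ‖ ^ 2 := by
    by_contra! h
    have h0 : ‖ι φ‖ ^ 2 = 0 := le_antisymm h (sq_nonneg _)
    have := hcoer φ
    rw [h0] at this
    nlinarith [sq_nonneg ‖φ‖]
  have hC : 0 < C := by
    by_contra! h
    have := hcoer φ
    nlinarith [sq_nonneg ‖φ‖]
  set R : Set ℝ := {r | ∃ x, ι x ≠ 0 ∧ r = B x x / ‖ι x‖ ^ 2} with hR
  have hφR : B φ φ / ‖ι φ‖ ^ 2 ∈ R := ⟨φ, fun h => by simp [h] at hφ, rfl⟩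
  have hRbdd : ∀ r ∈ R, -C ≤ r := by
    rintro r ⟨x, hx, rfl⟩
    rw [le_div_iff₀ (pow_pos (norm_pos_iff.2 hx) 2)]
    nlinarith [hcoer x, sq_nonneg ‖x‖]
  have hBdd : BddBelow R := ⟨-C, hRbdd⟩
  set m := sInf R with hm
  have hm0 : m < 0 := (csInf_le hBdd hφR).trans_lt (div_neg_of_neg_of_pos hneg hφ)
  have hmC : -C ≤ m := le_csInf ⟨_, hφR⟩ hRbdd
  set Bm : E →L[ℝ] E →L[ℝ] ℝ := B - m • innerForm ι ι with hBm
  have hBm_apply : ∀ x y, Bm x y = B x y - m * inner ℝ (ι x) (ι y) := fun x y => rfl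
  have hBm_symm : ∀ x y, Bm x y = Bm y x := fun x y => by
    rw [hBm_apply, hBm_apply, hsymm, real_inner_comm]
  have hBm_nonneg : ∀ x, 0 ≤ Bm x x := fun x => by
    rw [hBm_apply, real_inner_self_eq_norm_sq]
    rcases eq_or_ne (ι x) 0 with h | h
    · have := hcoer x
      rw [h] at this ⊢
      simp only [norm_zero, ne_eq, OfNat.ofNat_ne_zero, not_false_eq_true, zero_pow, mul_zero,
        add_zero, sub_zero] at this ⊢
      exact (mul_nonneg hc.le (sq_nonneg _)).trans this
    · have h1 := csInf_le hBdd (⟨x, h, rfl⟩ : B x x / ‖ι x‖ ^ 2 ∈ R)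
      rw [← hm, le_div_iff₀ (pow_pos (norm_pos_iff.2 h) 2)] at h1
      linarith
  set H : Submodule ℝ E := (innerForm ι ι φ).ker with hH
  have hmemH : ∀ k, k ∈ H ↔ inner ℝ (ι φ) (ι k) = 0 := fun k => Iff.rfl
  have hHc : CompleteSpace H := (innerForm ι ι φ).isClosed_ker.completeSpace_coe
  have hgap : ∀ k ∈ H, -m * ‖ι k‖ ^ 2 ≤ Bm k k := fun k hk => by
    rw [hBm_apply, real_inner_self_eq_norm_sq]
    linarith [hperp k ((hmemH k).1 hk)]
  have hcoerH : IsCoercive (Bm.bilinearComp H.subtypeL H.subtypeL) := by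
    refine ⟨-m * c / C, div_pos (mul_pos (neg_pos.2 hm0) hc) hC, fun k => ?_⟩
    change -m * c / C * ‖(k : E)‖ * ‖(k : E)‖ ≤ Bm k k
    have h1 := hgap k k.2
    have h2 := hcoer k
    have h3 : c * ‖(k : E)‖ ^ 2 ≤ Bm k k + (C + m) * ‖ι k‖ ^ 2 := by
      rw [hBm_apply, real_inner_self_eq_norm_sq]; linarith
    rw [mul_assoc, ← pow_two, div_mul_eq_mul_div, div_le_iff₀ hC]
    nlinarith [mul_le_mul_of_nonneg_left h3 (neg_pos.2 hm0).le,
      mul_le_mul_of_nonneg_left h1 (by linarith : 0 ≤ C + m)]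
  obtain ⟨w, hw⟩ : ∃ w : H, ∀ k : H, Bm w k = -Bm φ k := by
    refine ⟨hcoerH.continuousLinearEquivOfBilin.symm ((InnerProductSpace.toDual ℝ H).symm
      (-((Bm φ).comp H.subtypeL))), fun k => ?_⟩
    have h1 := hcoerH.continuousLinearEquivOfBilin_apply
      (hcoerH.continuousLinearEquivOfBilin.symm ((InnerProductSpace.toDual ℝ H).symm
      (-((Bm φ).comp H.subtypeL)))) k
    rw [ContinuousLinearEquiv.apply_symm_apply, InnerProductSpace.toDual_symm_apply] at h1
    exact h1.symm
  set y : E := φ + w with hy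
  have hyk : ∀ k ∈ H, Bm y k = 0 := fun k hk => by
    have := hw ⟨k, hk⟩
    simp only at this
    rw [hy, map_add, add_apply, this, add_neg_cancel]
  have hιy : inner ℝ (ι φ) (ι y) = ‖ι φ‖ ^ 2 := by
    rw [hy, map_add, inner_add_right, (hmemH w).1 w.2, add_zero, real_inner_self_eq_norm_sq]
  have hy0 : ι y ≠ 0 := fun h => by
    rw [h, inner_zero_right] at hιy
    linarith
  -- every vector is a multiple of `y` plus an element of `H`
  have hdec : ∀ x, ∃ a : ℝ, x - a • y ∈ H := fun x =>
    ⟨inner ℝ (ι φ) (ι x) / ‖ι φ‖ ^ 2, by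
      rw [hmemH, map_sub, map_smul, inner_sub_right, real_inner_smul_right, hιy,
        div_mul_cancel₀ _ hφ.ne', sub_self]⟩
  have hyy : Bm y y = 0 := by
    by_contra hne
    have hpos : 0 < Bm y y := lt_of_le_of_ne (hBm_nonneg y) (Ne.symm hne)
    have hyn : 0 < ‖ι y‖ ^ 2 := pow_pos (norm_pos_iff.2 hy0) 2
    set ε := min (Bm y y / (2 * ‖ι y‖ ^ 2)) (-m / 2) with hε
    have hε0 : 0 < ε := lt_min (div_pos hpos (by linarith)) (by linarith)
    have hε1 : 2 * ε * ‖ι y‖ ^ 2 ≤ Bm y y := by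
      have := min_le_left (Bm y y / (2 * ‖ι y‖ ^ 2)) (-m / 2)
      rw [← hε, le_div_iff₀ (by linarith)] at this
      linarith
    have hε2 : 2 * ε ≤ -m := by
      have := min_le_right (Bm y y / (2 * ‖ι y‖ ^ 2)) (-m / 2)
      rw [← hε] at this
      linarith
    have hle : ∀ x, ε * ‖ι x‖ ^ 2 ≤ Bm x x := fun x => by
      obtain ⟨a, ha⟩ := hdec x
      set k := x - a • y with hk
      have hx : x = a • y + k := by rw [hk]; abel
      have h1 : Bm x x = a ^ 2 * Bm y y + Bm k k := by
        rw [hx]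
        simp only [map_add, map_smul, add_apply, smul_apply,
          smul_eq_mul, hyk k ha, hBm_symm k y]
        ring
      have h2 : ‖ι x‖ ^ 2 ≤ 2 * (a ^ 2 * ‖ι y‖ ^ 2) + 2 * ‖ι k‖ ^ 2 := by
        have h3 := parallelogram_law_with_norm ℝ (a • ι y) (ι k)
        have h4 : ι x = a • ι y + ι k := by rw [hx, map_add, map_smul]
        rw [h4]
        rw [norm_smul] at h3
        have h5 : (‖a‖ * ‖ι y‖) * (‖a‖ * ‖ι y‖) = a ^ 2 * ‖ι y‖ ^ 2 := by
          rw [Real.norm_eq_abs, ← sq_abs a]; ring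
        nlinarith [mul_self_nonneg ‖a • ι y - ι k‖]
      have h3 := hgap k ha
      rw [h1]
      nlinarith [mul_le_mul_of_nonneg_left h2 hε0.le,
        mul_le_mul_of_nonneg_left hε1 (sq_nonneg a),
        mul_le_mul_of_nonneg_right hε2 (sq_nonneg ‖ι k‖)]
    have : m + ε ≤ m := le_csInf ⟨_, hφR⟩ (by
      rintro r ⟨x, hx, rfl⟩
      rw [le_div_iff₀ (pow_pos (norm_pos_iff.2 hx) 2)]
      have := hle x
      rw [hBm_apply, real_inner_self_eq_norm_sq] at this
      linarith)
    linarith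
  refine ⟨m, hm0, y, hy0, fun k => ?_⟩
  obtain ⟨a, ha⟩ := hdec k
  have h1 := hyk _ ha
  rw [map_sub, map_smul, hyy, smul_zero, sub_zero, hBm_apply] at h1
  linarith

/-! ### The linearized operator -/

theorem mem_linDomain {h k k₂ g g₂ : L2} (hk : IsWeakDeriv h k) (hk₂ : IsWeakDeriv k k₂)
    (hg : IsWeakDeriv g h) (hg₂ : IsWeakDeriv g₂ g) : h ∈ linDomain :=
  ⟨⟨⟨k, hk⟩, by rw [hk.dx_eq]; exact ⟨k₂, hk₂⟩⟩, ⟨⟨g, hg⟩, by rw [hg.dxInv_eq]; exact ⟨g₂, hg₂⟩⟩⟩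

theorem exists_of_mem_linDomain {h : L2} (hh : h ∈ linDomain) :
    ∃ k k₂ g g₂ : L2, IsWeakDeriv h k ∧ IsWeakDeriv k k₂ ∧ IsWeakDeriv g h ∧
      IsWeakDeriv g₂ g := by
  obtain ⟨⟨⟨k, hk⟩, h1⟩, ⟨⟨g, hg⟩, h2⟩⟩ := hh
  rw [hk.dx_eq] at h1
  rw [hg.dxInv_eq] at h2
  obtain ⟨k₂, hk₂⟩ := h1
  obtain ⟨g₂, hg₂⟩ := h2
  exact ⟨k, k₂, g, g₂, hk, hk₂, hg, hg₂⟩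

section LinOp

variable {om μ ν : ℝ} {V : ℝ → ℝ} {T : L2 →L[ℝ] L2}

theorem linOp_ae_eq (hT : ∀ u : L2, T u =ᵐ[volume] fun x => V x * u x)
    {h k k₂ g g₂ : L2} (hk : IsWeakDeriv h k) (hk₂ : IsWeakDeriv k k₂)
    (hg : IsWeakDeriv g h) (hg₂ : IsWeakDeriv g₂ g) :
    (-k₂ - g₂ - om • h - T h : L2) =ᵐ[volume] linOp om V h := by
  filter_upwards [Lp.coeFn_sub (-k₂ - g₂ - om • h) (T h), Lp.coeFn_sub (-k₂ - g₂) (om • h),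
    Lp.coeFn_sub (-k₂) g₂, Lp.coeFn_neg k₂, Lp.coeFn_smul om h, hT h] with x h1 h2 h3 h4 h5 h6
  rw [linOp, hk.dx_eq, hk₂.dx_eq, hg.dxInv_eq, hg₂.dxInv_eq, h1, Pi.sub_apply, h2, Pi.sub_apply,
    h3, Pi.sub_apply, h4, h5, h6]
  rfl

/-- The operator `-∂ₓ² - ∂ₓ⁻² - om - T` is given by its quadratic form. -/
theorem inner_linOp_eq {h k k₂ g g₂ h' k' g' : L2} (hk₂ : IsWeakDeriv k k₂)
    (hg₂ : IsWeakDeriv g₂ g) (hk' : IsWeakDeriv h' k') (hg' : IsWeakDeriv g' h') :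
    inner ℝ (-k₂ - g₂ - om • h - T h) h' =
      inner ℝ k k' + inner ℝ g g' - om * inner ℝ h h' - inner ℝ (T h) h' := by
  have h1 := hk₂.inner_eq_neg hk'
  have h2 := hg₂.inner_eq_neg hg'
  simp only [inner_sub_left, inner_neg_left, real_inner_smul_left]
  linarith

theorem inner_mul_operator_comm (hT : ∀ u : L2, T u =ᵐ[volume] fun x => V x * u x) (u v : L2) :
    inner ℝ (T u) v = inner ℝ (T v) u := by
  rw [L2.inner_eq, L2.inner_eq]
  refine integral_congr_ae ?_
  filter_upwards [hT u, hT v] with x h1 h2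
  rw [h1, h2]; ring

/-- Eigenfunctions solve the eigenvalue problem in weak form. -/
theorem IsEigenfunction.exists_weak (hT : ∀ u : L2, T u =ᵐ[volume] fun x => V x * u x) {h : L2}
    (hh : IsEigenfunction (linOp om V) μ h) :
    ∃ k g : L2, IsWeakDeriv h k ∧ IsWeakDeriv g h ∧ ∀ h' k' g' : L2, IsWeakDeriv h' k' →
      IsWeakDeriv g' h' → inner ℝ k k' + inner ℝ g g' - om * inner ℝ h h' - inner ℝ (T h) h' =
        μ * inner ℝ h h' := by
  obtain ⟨hdom, -, heq⟩ := hh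
  obtain ⟨k, k₂, g, g₂, hk, hk₂, hg, hg₂⟩ := exists_of_mem_linDomain hdom
  refine ⟨k, g, hk, hg, fun h' k' g' hk' hg' => ?_⟩
  have e : (-k₂ - g₂ - om • h - T h : L2) = μ • h := by
    refine Lp.ext ?_
    filter_upwards [linOp_ae_eq (om := om) hT hk hk₂ hg hg₂, heq, Lp.coeFn_smul μ h] with x h1 h2 h3
    rw [h1, h2, h3]; rfl
  rw [← inner_linOp_eq hk₂ hg₂ hk' hg', e, real_inner_smul_left]

/-- Weak eigenfunctions in `H¹ ∩ Ḣ⁻¹` are eigenfunctions. -/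
theorem isEigenfunction_of_weak (hT : ∀ u : L2, T u =ᵐ[volume] fun x => V x * u x) {h k g : L2}
    (hne : h ≠ 0) (hk : IsWeakDeriv h k) (hg : IsWeakDeriv g h)
    (hweak : ∀ h' k' g' : L2, IsWeakDeriv h' k' → IsWeakDeriv g' h' →
      inner ℝ k k' + inner ℝ g g' - om * inner ℝ h h' - inner ℝ (T h) h' = μ * inner ℝ h h') :
    IsEigenfunction (linOp om V) μ h := by
  obtain ⟨k₂, g₂, hk₂, hg₂, e⟩ := exists_isWeakDeriv_of_weak_solution (f := om • h + T h + μ • h)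
    hk hg fun h' k' g' hk' hg' => by
      have := hweak h' k' g' hk' hg'
      simp only [inner_add_left, real_inner_smul_left]
      linarith
  refine ⟨mem_linDomain hk hk₂ hg hg₂, hne, ?_⟩
  have e' : (-k₂ - g₂ - om • h - T h : L2) = μ • h := by rw [e]; abel
  filter_upwards [linOp_ae_eq (om := om) hT hk hk₂ hg hg₂, Lp.coeFn_smul μ h] with x h1 h2
  rw [← h1, e', h2]; rfl

/-- The quadratic form of `-∂ₓ² - ∂ₓ⁻² - om - T` on `H¹ ∩ Ḣ⁻¹` is nonnegative on `φ^⊥`. -/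
def FormNonnegOnPerp (om : ℝ) (T : L2 →L[ℝ] L2) (φ : L2) : Prop :=
  ∀ h k g : L2, IsWeakDeriv h k → IsWeakDeriv g h → inner ℝ φ h = 0 →
    0 ≤ ‖k‖ ^ 2 + ‖g‖ ^ 2 - om * ‖h‖ ^ 2 - inner ℝ (T h) h

theorem FormNonnegOnPerp.nonnegOnPerp (hT : ∀ u : L2, T u =ᵐ[volume] fun x => V x * u x) {φ : L2}
    (hperp : FormNonnegOnPerp om T φ) : NonnegOnPerp (linOp om V) φ := by
  intro h hdom horth
  obtain ⟨k, k₂, g, g₂, hk, hk₂, hg, hg₂⟩ := exists_of_mem_linDomain hdom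
  have e : ∫ x, linOp om V h x * h x = inner ℝ (-k₂ - g₂ - om • h - T h) h := by
    rw [L2.inner_eq]
    exact integral_congr_ae ((linOp_ae_eq (om := om) hT hk hk₂ hg hg₂).mono fun x hx => by
      simp only [hx])
  rw [e, inner_linOp_eq hk₂ hg₂ hk hg]
  simp only [real_inner_self_eq_norm_sq]
  exact hperp h k g hk hg (by rw [real_inner_comm, L2.inner_eq]; exact horth)

/-- Negative eigenvalues are unique and simple: two linearly independent eigenfunctions would have
a combination orthogonal to `φ` at which the form is negative. -/
theorem FormNonnegOnPerp.eigenfunction_unique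
    (hT : ∀ u : L2, T u =ᵐ[volume] fun x => V x * u x) {φ ψ h : L2}
    (hperp : FormNonnegOnPerp om T φ) (hμ : μ < 0) (hν : ν < 0)
    (hψ : IsEigenfunction (linOp om V) μ ψ) (hh : IsEigenfunction (linOp om V) ν h) :
    ν = μ ∧ ∃ c : ℝ, h = c • ψ := by
  obtain ⟨k, g, hk, hg, hw⟩ := hh.exists_weak hT
  obtain ⟨k', g', hk', hg', hw'⟩ := hψ.exists_weak hT
  have hψ0 : 0 < ‖ψ‖ ^ 2 := pow_pos (norm_pos_iff.2 hψ.2.1) 2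
  have hh0 : 0 < ‖h‖ ^ 2 := pow_pos (norm_pos_iff.2 hh.2.1) 2
  have e1 := hw h k g hk hg
  have e2 := hw' ψ k' g' hk' hg'
  have e3 := hw ψ k' g' hk' hg'
  have e4 := hw' h k g hk hg
  have hTc := inner_mul_operator_comm hT h ψ
  rw [real_inner_comm k k', real_inner_comm g g', real_inner_comm h ψ] at e4
  simp only [real_inner_self_eq_norm_sq] at e1 e2
  set α := inner ℝ φ ψ with hα
  set β := inner ℝ φ h with hβ
  have hα0 : α ≠ 0 := fun h0 => by
    have := hperp ψ k' g' hk' hg' h0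
    rw [e2] at this
    nlinarith
  -- this combination is orthogonal to `φ`
  have hz := hperp (α • h - β • ψ) (α • k - β • k') (α • g - β • g')
    ((hk.smul α).sub (hk'.smul β)) ((hg.smul α).sub (hg'.smul β)) (by
      rw [inner_sub_right, real_inner_smul_right, real_inner_smul_right, ← hα, ← hβ]; ring)
  have hexp : ∀ a b : L2, ‖α • a - β • b‖ ^ 2 =
      α ^ 2 * ‖a‖ ^ 2 - 2 * (α * β) * inner ℝ a b + β ^ 2 * ‖b‖ ^ 2 := fun a b => by
    rw [norm_sub_sq_real, norm_smul, norm_smul, real_inner_smul_left, real_inner_smul_right,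
      mul_pow, mul_pow, Real.norm_eq_abs, Real.norm_eq_abs, sq_abs, sq_abs]
    ring
  have hTz : inner ℝ (T (α • h - β • ψ)) (α • h - β • ψ) =
      α ^ 2 * inner ℝ (T h) h - 2 * (α * β) * inner ℝ (T h) ψ + β ^ 2 * inner ℝ (T ψ) ψ := by
    simp only [map_sub, map_smul, inner_sub_left, inner_sub_right, real_inner_smul_left,
      real_inner_smul_right]
    rw [← hTc]; ring
  have hform : ‖α • k - β • k'‖ ^ 2 + ‖α • g - β • g'‖ ^ 2 - om * ‖α • h - β • ψ‖ ^ 2 -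
      inner ℝ (T (α • h - β • ψ)) (α • h - β • ψ) =
      α ^ 2 * (ν * ‖h‖ ^ 2) - 2 * (α * β) * (ν * inner ℝ h ψ) + β ^ 2 * (μ * ‖ψ‖ ^ 2) := by
    rw [hexp, hexp, hexp, hTz]
    linear_combination α ^ 2 * e1 - 2 * (α * β) * e3 + β ^ 2 * e2
  rw [hform] at hz
  have hνμ : ν = μ := by
    by_contra hne
    have h0 : inner ℝ h ψ = 0 := by
      have : (ν - μ) * inner ℝ h ψ = 0 := by linarith
      exact (mul_eq_zero.1 this).resolve_left (sub_ne_zero.2 hne)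
    rw [h0] at hz
    have h1 : α ^ 2 * (ν * ‖h‖ ^ 2) < 0 :=
      mul_neg_of_pos_of_neg (by positivity) (mul_neg_of_neg_of_pos hν hh0)
    have h2 : β ^ 2 * (μ * ‖ψ‖ ^ 2) ≤ 0 :=
      mul_nonpos_of_nonneg_of_nonpos (sq_nonneg β) (mul_neg_of_neg_of_pos hμ hψ0).le
    linarith
  refine ⟨hνμ, β / α, ?_⟩
  have h1 : μ * ‖α • h - β • ψ‖ ^ 2 ≥ 0 := by
    rw [hexp, ← hνμ]
    rw [← hνμ] at hz
    linarith
  have h2 : α • h - β • ψ = 0 := by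
    rw [← norm_eq_zero, ← sq_eq_zero_iff]
    nlinarith [sq_nonneg ‖α • h - β • ψ‖]
  rw [div_eq_inv_mul, mul_smul, ← sub_eq_zero.1 h2, smul_smul, inv_mul_cancel₀ hα0, one_smul]

/-- The Hilbert space `H¹ ∩ Ḣ⁻¹`, realized as the space of triples `(∂ₓ⁻¹u, u, ∂ₓu)`. -/
def formDomain : Submodule ℝ (PiLp 2 fun _ : Fin 3 => L2) where
  carrier := {z | IsWeakDeriv (z 0) (z 1) ∧ IsWeakDeriv (z 1) (z 2)}
  add_mem' h h' := ⟨h.1.add h'.1, h.2.add h'.2⟩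
  zero_mem' := ⟨isWeakDeriv_zero, isWeakDeriv_zero⟩
  smul_mem' c _ h := ⟨h.1.smul c, h.2.smul c⟩

theorem isClosed_formDomain : IsClosed (formDomain : Set (PiLp 2 fun _ : Fin 3 => L2)) :=
  (isClosed_isWeakDeriv (by fun_prop) (by fun_prop)).inter
    (isClosed_isWeakDeriv (by fun_prop) (by fun_prop))

theorem FormNonnegOnPerp.exists_eigenfunction
    (hT : ∀ u : L2, T u =ᵐ[volume] fun x => V x * u x) {φ φ₁ φm : L2}
    (hperp : FormNonnegOnPerp om T φ) (hφ₁ : IsWeakDeriv φ φ₁) (hφm : IsWeakDeriv φm φ)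
    (hneg : ‖φ₁‖ ^ 2 + ‖φm‖ ^ 2 - om * ‖φ‖ ^ 2 - inner ℝ (T φ) φ < 0) :
    ∃ μ < 0, ∃ ψ : L2, IsEigenfunction (linOp om V) μ ψ := by
  have hcomp : CompleteSpace formDomain := isClosed_formDomain.completeSpace_coe
  let π : Fin 3 → formDomain →L[ℝ] L2 := fun i =>
    (PiLp.proj 2 (𝕜 := ℝ) (fun _ : Fin 3 => L2) i).comp formDomain.subtypeL
  set B : formDomain →L[ℝ] formDomain →L[ℝ] ℝ :=
    innerForm (π 2) (π 2) + innerForm (π 0) (π 0) - om • innerForm (π 1) (π 1) -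
      innerForm (T.comp (π 1)) (π 1)
  have hB : ∀ x y, B x y = inner ℝ (π 2 x) (π 2 y) + inner ℝ (π 0 x) (π 0 y) -
      om * inner ℝ (π 1 x) (π 1 y) - inner ℝ (T (π 1 x)) (π 1 y) := fun x y => rfl
  have hn : ∀ x : formDomain, ‖x‖ ^ 2 = ‖π 0 x‖ ^ 2 + ‖π 1 x‖ ^ 2 + ‖π 2 x‖ ^ 2 := fun x => by
    change ‖(x : PiLp 2 fun _ : Fin 3 => L2)‖ ^ 2 = _
    rw [PiLp.norm_sq_eq_of_L2, Fin.sum_univ_three]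
    rfl
  have hdom : ∀ {h k g : L2}, IsWeakDeriv h k → IsWeakDeriv g h →
      ∃ x, π 0 x = g ∧ π 1 x = h ∧ π 2 x = k := fun {h k g} hk hg =>
    ⟨⟨WithLp.toLp 2 ![g, h, k], hg, hk⟩, rfl, rfl, rfl⟩
  obtain ⟨φX, h0, h1, h2⟩ := hdom hφ₁ hφm
  obtain ⟨μ, hμ, y, hy0, hy⟩ := exists_negative_eigenvector (π 1) B (fun x y => by
      rw [hB, hB, real_inner_comm (π 2 x), real_inner_comm (π 0 x), real_inner_comm (π 1 x),
        inner_mul_operator_comm hT]) (c := 1) (C := 1 + om + ‖T‖) one_pos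
    (fun x => by
      rw [hn, hB]
      simp only [real_inner_self_eq_norm_sq]
      have : inner ℝ (T (π 1 x)) (π 1 x) ≤ ‖T‖ * ‖π 1 x‖ ^ 2 := by
        refine (real_inner_le_norm _ _).trans ?_
        rw [pow_two, ← mul_assoc]
        exact mul_le_mul_of_nonneg_right (T.le_opNorm _) (norm_nonneg _)
      linarith) (φ := φX)
    (by
      rw [hB, h0, h1, h2]
      simpa only [real_inner_self_eq_norm_sq] using hneg)
    (fun x hx => by
      rw [hB]
      simp only [real_inner_self_eq_norm_sq]
      rw [h1] at hx
      exact hperp _ _ _ x.2.2 x.2.1 hx)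
  refine ⟨μ, hμ, π 1 y, isEigenfunction_of_weak hT hy0 (k := π 2 y) (g := π 0 y) y.2.2 y.2.1
    fun h' k' g' hk' hg' => ?_⟩
  obtain ⟨x, rfl, rfl, rfl⟩ := hdom hk' hg'
  rw [← hB, hy]

end LinOp

/-! ### Constrained minimizers -/

theorem integral_sq_abs (u : L2) : ∫ x, |u x| ^ 2 = ‖u‖ ^ 2 := by
  rw [← real_inner_self_eq_norm_sq, L2.inner_eq]
  exact integral_congr_ae (Eventually.of_forall fun x => by
    simp only [pow_two, abs_mul_abs_self])

theorem integrable_sq_abs (u : L2) : Integrable fun x => |u x| ^ 2 := by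
  simpa only [pow_two, abs_mul_abs_self] using L2.integrable_mul_self u u

theorem integral_sq_add_sq (u v : L2) : ∫ x, (|u x| ^ 2 + |v x| ^ 2) = ‖u‖ ^ 2 + ‖v‖ ^ 2 := by
  rw [integral_add (integrable_sq_abs u) (integrable_sq_abs v), integral_sq_abs, integral_sq_abs]

section Minimizer

variable {F N N' : ℝ → ℝ} {E : L2 → ℝ} {lam om : ℝ} {φ φ₁ φm n : L2}

theorem IsMinimizer.isSphereMinimizer
    (hE : ∀ u, E u = 1 / 2 * (∫ x, (|dx u x| ^ 2 + |dxInv u x| ^ 2)) - ∫ x, F (u x))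
    (hφ : IsMinimizer E lam φ) : IsSphereMinimizer F φ (dx φ) (dxInv φ) := by
  obtain ⟨⟨⟨φ₁, h1⟩, ⟨φm, h2⟩, h3⟩, hmin⟩ := hφ
  rw [h1.dx_eq, h2.dxInv_eq]
  refine ⟨h1, h2, fun u v w hv hw hu => ?_⟩
  have := hmin u ⟨⟨v, hv⟩, ⟨w, hw⟩, by rw [integral_sq_abs, hu, ← h3, integral_sq_abs]⟩
  rwa [hE, hE, hv.dx_eq, hw.dxInv_eq, h1.dx_eq, h2.dxInv_eq, integral_sq_add_sq,
    integral_sq_add_sq] at this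

/-- The Euler-Lagrange equation holds in `L²`. -/
theorem IsSphereMinimizer.exists_strong_solution (hN : IsNonlinearity F N N')
    (hφ : IsSphereMinimizer F φ φ₁ φm) (hφ0 : φ ≠ 0) (hn : n =ᵐ[volume] fun x => N (φ x))
    (hom : om * ‖φ‖ ^ 2 = ‖φ₁‖ ^ 2 + ‖φm‖ ^ 2 - inner ℝ n φ) :
    ∃ φ₂ φmm : L2, IsWeakDeriv φ₁ φ₂ ∧ IsWeakDeriv φmm φm ∧ -φ₂ - φmm = om • φ + n := by
  obtain ⟨T, hT⟩ := hN.exists_deriv_operator hφ.deriv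
  exact exists_isWeakDeriv_of_weak_solution hφ.deriv hφ.antideriv fun h k g hk hg =>
    (hφ.euler_lagrange hN hφ0 hn hT hom hk hg).1

/-- For a nonlinearity satisfying `N'(z) z = p N(z)` with `p > 1`, the form of the linearized
operator takes the value `(1 - p) ∫ N(φ) φ` at `φ`, so that it is negative there as soon as
`∫ N(φ) φ > 0`. -/
theorem IsSphereMinimizer.profile_and_spectrum (hN : IsNonlinearity F N N') {p : ℝ} (hp : 1 < p)
    (hpN : ∀ z, N' z * z = p * N z) (hφ : IsSphereMinimizer F φ φ₁ φm) (hφ0 : φ ≠ 0)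
    (hn : n =ᵐ[volume] fun x => N (φ x)) (hpos : 0 < inner ℝ n φ)
    (hom : om * ‖φ‖ ^ 2 = ‖φ₁‖ ^ 2 + ‖φm‖ ^ 2 - inner ℝ n φ) :
    SolvesProfile om N φ ∧ NonnegOnPerp (linOp om fun x => N' (φ x)) φ ∧
      HasExactlyOneNegativeEigenvalue (linOp om fun x => N' (φ x)) := by
  obtain ⟨T, hT⟩ := hN.exists_deriv_operator hφ.deriv
  have hperp : FormNonnegOnPerp om T φ := fun h k g hk hg =>
    (hφ.euler_lagrange hN hφ0 hn hT hom hk hg).2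
  refine ⟨?_, hperp.nonnegOnPerp hT, ?_⟩
  · obtain ⟨φ₂, φmm, h1, h2, e⟩ := hφ.exists_strong_solution hN hφ0 hn hom
    have hd := mem_linDomain hφ.deriv h1 hφ.antideriv h2
    refine ⟨hd.1, hd.2, ?_⟩
    have e' : φ₂ + φmm + om • φ + n = 0 := by
      rw [add_assoc, ← e]; abel
    rw [hφ.deriv.dx_eq, h1.dx_eq, hφ.antideriv.dxInv_eq, h2.dxInv_eq]
    have h0 := Lp.coeFn_zero ℝ 2 (volume : Measure ℝ)
    rw [← e'] at h0
    filter_upwards [h0, Lp.coeFn_add (φ₂ + φmm + om • φ) n, Lp.coeFn_add (φ₂ + φmm) (om • φ),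
      Lp.coeFn_add φ₂ φmm, Lp.coeFn_smul om φ, hn] with x a1 a2 a3 a4 a5 a6
    rw [a2, Pi.add_apply, a3, Pi.add_apply, a4, a5, a6] at a1
    exact a1
  · have hTφ : T φ = p • n := by
      refine Lp.ext ?_
      filter_upwards [hT φ, hn, Lp.coeFn_smul p n] with x a1 a2 a3
      rw [a1, a3, Pi.smul_apply, a2, hpN, smul_eq_mul]
    obtain ⟨μ, hμ, ψ, hψ⟩ := hperp.exists_eigenfunction hT hφ.deriv hφ.antideriv (by
      rw [hTφ, hom, real_inner_smul_left]
      nlinarith)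
    exact ⟨μ, hμ, ψ, hψ, fun ν hν h hh => hperp.eigenfunction_unique hT hμ hν hψ hh⟩

theorem IsMinimizer.ne_zero (hlam : 0 < lam) (hφ : IsMinimizer E lam φ) : φ ≠ 0 := by
  rintro rfl
  have := hφ.1.2.2
  rw [integral_sq_abs] at this
  simp at this
  linarith

theorem multiplier_mul_norm_sq (hlam : 0 < lam) (hφ : IsMinimizer E lam φ)
    (hn : n =ᵐ[volume] fun x => N (φ x))
    (hom : om = 1 / lam * ∫ x, (|dx φ x| ^ 2 + |dxInv φ x| ^ 2 - N (φ x) * φ x)) :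
    om * ‖φ‖ ^ 2 = ‖dx φ‖ ^ 2 + ‖dxInv φ‖ ^ 2 - inner ℝ n φ := by
  have e : (fun x => n x * φ x) =ᵐ[volume] fun x => N (φ x) * φ x :=
    hn.mono fun x hx => by simp only [hx]
  have hi := (L2.integrable_mul_self n φ).congr e
  rw [← integral_sq_abs φ, hφ.1.2.2, hom, integral_sub (f := fun x => |dx φ x| ^ 2 + |dxInv φ x| ^ 2)
    ((integrable_sq_abs _).add (integrable_sq_abs _)) hi, integral_sq_add_sq, L2.inner_eq,
    integral_congr_ae e]
  field_simp

end Minimizer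

/-! ### Power nonlinearities -/

theorem abs_rpow_sub_two_mul_mul {p : ℝ} (hp : 1 < p) (z : ℝ) :
    |z| ^ (p - 2) * z * z = |z| ^ p := by
  rcases eq_or_ne z 0 with rfl | hz
  · simp [Real.zero_rpow (by linarith : p ≠ 0)]
  · have : 0 < |z| := abs_pos.2 hz
    rw [mul_assoc, ← pow_two, ← sq_abs, ← Real.rpow_natCast, ← Real.rpow_add this]
    norm_num

theorem isNonlinearity_abs_rpow {p : ℝ} (hp : 1 < p) :
    IsNonlinearity (fun z => 1 / (p + 1) * (|z| ^ p * z)) (fun z => |z| ^ p)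
      (fun z => p * (|z| ^ (p - 2) * z)) where
  hasDerivAt_potential z := by
    refine (((hasDerivAt_abs_rpow z hp).mul (hasDerivAt_id z)).const_mul _).congr_deriv ?_
    have := abs_rpow_sub_two_mul_mul hp z
    have hp1 : p + 1 ≠ 0 := by linarith
    simp only [id_eq]
    field_simp
    linear_combination p * this
  hasDerivAt z := (hasDerivAt_abs_rpow z hp).congr_deriv (by ring)
  continuous_deriv := by
    have h := (contDiff_norm_rpow (E := ℝ) hp).continuous_deriv le_rfl
    refine h.congr fun z => ?_
    rw [(hasDerivAt_norm_rpow z hp).deriv, Real.norm_eq_abs]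
    ring
  potential_zero := by simp
  zero := by simp [Real.zero_rpow (by linarith : p ≠ 0)]

theorem continuous_abs_rpow {q : ℝ} (hq : 0 ≤ q) : Continuous fun z : ℝ => |z| ^ q :=
  (Real.continuous_rpow_const hq).comp continuous_abs

theorem abs_rpow_sub_one_mul_mul {p : ℝ} (hp : 1 < p) (z : ℝ) :
    |z| ^ (p - 1) * z * z = |z| ^ (p + 1) := by
  have := abs_rpow_sub_two_mul_mul (p := p + 1) (by linarith) z
  rwa [show p + 1 - 2 = p - 1 by ring] at this

theorem isNonlinearity_abs_rpow_mul {p : ℝ} (hp : 1 < p) :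
    IsNonlinearity (fun z => 1 / (p + 1) * |z| ^ (p + 1)) (fun z => |z| ^ (p - 1) * z)
      (fun z => p * |z| ^ (p - 1)) where
  hasDerivAt_potential z := by
    refine ((hasDerivAt_abs_rpow z (by linarith : 1 < p + 1)).const_mul _).congr_deriv ?_
    have hp1 : p + 1 ≠ 0 := by linarith
    rw [show p + 1 - 2 = p - 1 by ring]
    field_simp
  hasDerivAt z := by
    have hcont := continuous_abs_rpow (by linarith : 0 ≤ p - 1)
    have hne : ∀ y ≠ 0, HasDerivAt (fun z : ℝ => |z| ^ (p - 1) * z) (p * |y| ^ (p - 1)) y :=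
      fun y hy => by
        have hy' : |y| ≠ 0 := abs_ne_zero.2 hy
        refine (((hasDerivAt_abs hy).rpow_const (Or.inl hy')).mul (hasDerivAt_id y)).congr_deriv ?_
        have h1 : ((SignType.sign y : SignType) : ℝ) * y = |y| := sign_mul_self y
        have h2 : |y| ^ (p - 1 - 1) * |y| = |y| ^ (p - 1) := by
          rw [Real.rpow_sub_one hy', div_mul_cancel₀ _ hy']
        simp only [id_eq, mul_one]
        linear_combination (p - 1) * |y| ^ (p - 1 - 1) * h1 + (p - 1) * h2
    rcases eq_or_ne z 0 with rfl | hz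
    · exact hasDerivAt_of_hasDerivAt_of_ne hne (hcont.mul continuous_id).continuousAt
        (hcont.const_mul p).continuousAt
    · exact hne z hz
  continuous_deriv := (continuous_abs_rpow (by linarith : 0 ≤ p - 1)).const_mul p
  potential_zero := by simp [Real.zero_rpow (by linarith : p + 1 ≠ 0)]
  zero := by simp

/-- A minimizer `φ` of `energyI` has `∫ |φ|^p φ > 0`. A negative value would make `-φ` a better
competitor; if the value were `0`, then `-φ` would be a minimizer as well, and its Euler-Lagrange
equation has the opposite sign in front of `|φ|^p`. -/
theorem inner_pos_of_isMinimizer_energyI {p om : ℝ} (hp : 1 < p) {φ n : L2} (hφ0 : φ ≠ 0)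
    (hφ : IsSphereMinimizer (fun z => 1 / (p + 1) * (|z| ^ p * z)) φ (dx φ) (dxInv φ))
    (hn : n =ᵐ[volume] fun x => |φ x| ^ p)
    (hom : om * ‖φ‖ ^ 2 = ‖dx φ‖ ^ 2 + ‖dxInv φ‖ ^ 2 - inner ℝ n φ) : 0 < inner ℝ n φ := by
  have hN := isNonlinearity_abs_rpow hp
  have hp1 : 0 < 1 / (p + 1) := by positivity
  have hF : ∫ x, 1 / (p + 1) * (|φ x| ^ p * φ x) = 1 / (p + 1) * inner ℝ n φ := by
    rw [integral_const_mul, L2.inner_eq]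
    congr 1
    exact integral_congr_ae (hn.mono fun x hx => by simp only [hx])
  have hF' : ∫ x, 1 / (p + 1) * (|(-φ : L2) x| ^ p * (-φ : L2) x) =
      -(1 / (p + 1) * inner ℝ n φ) := by
    rw [← hF, ← integral_neg]
    refine integral_congr_ae ((Lp.coeFn_neg φ).mono fun x hx => ?_)
    simp only [hx, Pi.neg_apply, abs_neg]; ring
  have hle := hφ.le _ _ _ hφ.deriv.neg hφ.antideriv.neg (norm_neg φ)
  simp only [hF, hF', norm_neg] at hle
  have h0 : 0 ≤ inner ℝ n φ := by nlinarith
  refine lt_of_le_of_ne h0 fun hz => hφ0 ?_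
  have hφ' : IsSphereMinimizer (fun z => 1 / (p + 1) * (|z| ^ p * z)) (-φ) (-dx φ) (-dxInv φ) := by
    refine ⟨hφ.deriv.neg, hφ.antideriv.neg, fun u v w hv hw hu => ?_⟩
    have := hφ.le u v w hv hw (by rw [hu, norm_neg])
    simp only [hF, hF', norm_neg, ← hz] at this ⊢
    linarith
  obtain ⟨a, b, ha, hb, e1⟩ := hφ.exists_strong_solution hN hφ0 hn hom
  obtain ⟨a', b', ha', hb', e2⟩ := hφ'.exists_strong_solution hN (neg_ne_zero.2 hφ0) (n := n)
    (om := om) (by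
      filter_upwards [hn, Lp.coeFn_neg φ] with x h1 h2
      rw [h1, h2, Pi.neg_apply, abs_neg]) (by
      rw [norm_neg, norm_neg, norm_neg, inner_neg_right, hom, ← hz]; ring)
  rw [ha'.unique ha.neg, hb'.unique_left hb.neg] at e2
  have hn0 : n = 0 := by
    have : (2 : ℝ) • n = 0 := by
      calc (2 : ℝ) • n = (om • φ + n) + (om • -φ + n) := by module
        _ = 0 := by rw [← e1, ← e2]; abel
    simpa using this
  refine Lp.ext ?_
  rw [hn0] at hn
  filter_upwards [hn, Lp.coeFn_zero ℝ 2 (volume : Measure ℝ)] with x h1 h2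
  rw [h2, Pi.zero_apply] at h1 ⊢
  have := (Real.rpow_eq_zero (abs_nonneg (φ x)) (by linarith : p ≠ 0)).1 h1.symm
  exact abs_eq_zero.1 this

theorem inner_pos_of_abs_rpow_mul {p : ℝ} (hp : 1 < p) {φ n : L2} (hφ0 : φ ≠ 0)
    (hn : n =ᵐ[volume] fun x => |φ x| ^ (p - 1) * φ x) : 0 < inner ℝ n φ := by
  have e : ∀ᵐ x, n x * φ x = |φ x| ^ (p + 1) := hn.mono fun x hx => by
    rw [hx, abs_rpow_sub_one_mul_mul hp]
  have hnn : 0 ≤ᵐ[volume] fun x => n x * φ x := e.mono fun x hx => by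
    simp only [hx]; exact Real.rpow_nonneg (abs_nonneg _) _
  rw [L2.inner_eq]
  refine lt_of_le_of_ne (integral_nonneg_of_ae hnn) fun hz => hφ0 ?_
  have h0 := (integral_eq_zero_iff_of_nonneg_ae hnn (L2.integrable_mul_self n φ)).1 hz.symm
  refine Lp.ext ?_
  filter_upwards [h0, e, Lp.coeFn_zero ℝ 2 (volume : Measure ℝ)] with x h1 h2 h3
  rw [Pi.zero_apply] at h1
  rw [h1] at h2
  rw [h3, Pi.zero_apply]
  exact abs_eq_zero.1
    ((Real.rpow_eq_zero (abs_nonneg (φ x)) (by linarith : p + 1 ≠ 0)).1 h2.symm)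

end Ostrovsky

end

theorem proposition5 :
    (∀ p lam : ℝ, 1 < p → p < 3 → 0 < lam →
      ∀ φ : Ostrovsky.L2, Ostrovsky.IsMinimizer (Ostrovsky.energyI p) lam φ →
        Ostrovsky.SolvesProfile (Ostrovsky.omegaI p lam φ) (fun z => |z| ^ p) φ ∧
        Ostrovsky.NonnegOnPerp
          (Ostrovsky.linOp (Ostrovsky.omegaI p lam φ)
            (fun x => p * (|φ x| ^ (p - 2) * φ x))) φ ∧
        Ostrovsky.HasExactlyOneNegativeEigenvalue
          (Ostrovsky.linOp (Ostrovsky.omegaI p lam φ)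
            (fun x => p * (|φ x| ^ (p - 2) * φ x)))) ∧
    (∀ p lam : ℝ, 1 < p → p < 5 → 0 < lam →
      ∀ φ : Ostrovsky.L2, Ostrovsky.IsMinimizer (Ostrovsky.energyJ p) lam φ →
        Ostrovsky.SolvesProfile (Ostrovsky.omegaJ p lam φ) (fun z => |z| ^ (p - 1) * z) φ ∧
        Ostrovsky.NonnegOnPerp
          (Ostrovsky.linOp (Ostrovsky.omegaJ p lam φ)
            (fun x => p * |φ x| ^ (p - 1))) φ ∧
        Ostrovsky.HasExactlyOneNegativeEigenvalue
          (Ostrovsky.linOp (Ostrovsky.omegaJ p lam φ)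
            (fun x => p * |φ x| ^ (p - 1)))) := by
  constructor
  · intro p lam hp _ hlam φ hφ
    have hN := Ostrovsky.isNonlinearity_abs_rpow hp
    have hmin := hφ.isSphereMinimizer (F := fun z => 1 / (p + 1) * (|z| ^ p * z)) fun u => by
      rw [integral_const_mul]; rfl
    have hφ0 := hφ.ne_zero hlam
    obtain ⟨M, -, hM⟩ := hmin.deriv.exists_ae_bound
    obtain ⟨n, hn⟩ := hN.exists_comp hM
    have hom := Ostrovsky.multiplier_mul_norm_sq (N := fun z => |z| ^ p)
      (om := Ostrovsky.omegaI p lam φ) hlam hφ hn rfl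
    exact hmin.profile_and_spectrum hN hp
      (fun z => by rw [mul_assoc, Ostrovsky.abs_rpow_sub_two_mul_mul hp]) hφ0 hn
      (Ostrovsky.inner_pos_of_isMinimizer_energyI hp hφ0 hmin hn hom) hom
  · intro p lam hp _ hlam φ hφ
    have hN := Ostrovsky.isNonlinearity_abs_rpow_mul hp
    have hmin := hφ.isSphereMinimizer (F := fun z => 1 / (p + 1) * |z| ^ (p + 1)) fun u => by
      rw [integral_const_mul]; rfl
    have hφ0 := hφ.ne_zero hlam
    obtain ⟨M, -, hM⟩ := hmin.deriv.exists_ae_bound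
    obtain ⟨n, hn⟩ := hN.exists_comp hM
    have hom := Ostrovsky.multiplier_mul_norm_sq (N := fun z => |z| ^ (p - 1) * z)
      (om := Ostrovsky.omegaJ p lam φ) hlam hφ hn (by
      simp only [Ostrovsky.abs_rpow_sub_one_mul_mul hp]; rfl)
    exact hmin.profile_and_spectrum hN hp (fun z => by rw [mul_assoc]) hφ0 hn
      (Ostrovsky.inner_pos_of_abs_rpow_mul hp hφ0 hn) hom
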